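/- Fix a prime \(p\) and integers \(d,n\) with either \(n=2\) and \(d\ge 10\), or \(n\ge 3\) and \(d\ge 3\). Let \(F\) be the free group on \(d\) generators, with lower \(p\)-series \(F_1=F\), \(F_{i+1}=F_i^p[F_i,F]\), and let \(d_n\) be the rank of the elementary abelian group \(F_n/F_{n+1}\). The group \(\mathrm{GL}(d,\mathbb F_p)=\mathrm{Aut}(F/F_2)\) acts on \(F_n/F_{n+1}\): a matrix acts through any endomorphism of \(F\) that induces it on \(F/F_2\cong\mathbb F_p^d\). Let \(\mathcal C_{d,n}\) be the set of normal subgroups of \(F/F_{n+1}\) lying in \(F_n/F_{n+1}\) (that is, the subspaces of \(F_n/F_{n+1}\)), let \(\mathfrak C_{d,n}\) be the set of \(\mathrm{GL}(d,\mathbb F_p)\)-orbits in \(\mathcal C_{d,n}\), and let \(\mathfrak D_{d,n}\subseteq\mathfrak C_{d,n}\) be the set of regular orbits, i.e. those in which every point has trivial stabilizer. Put \[ C(q)=\sum_{r=-\infty}^{\infty}q^{-r^2},\qquad D(q)=\prod_{j=1}^{\infty}(1-q^{-j})^{-1}, \] \[ K=\begin{cases} C(p)^5D(p)^4p^{17/4}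 & n=2,\\ C(p)^2D(p)\,p^{3/4} & n\ge 3,\end{cases} \qquad x=\begin{cases} -d & n=2,\\ d^2-d_n/2 & n\ge 3.\end{cases} \] Then: (a) \(\displaystyle 1\le \frac{|\mathfrak C_{d,n}|\cdot|\mathrm{GL}(d,\mathbb F_p)|}{|\mathcal C_{d,n}|}\le 1+Kp^x.\) (b) \(|\mathfrak D_{d,n}|\le|\mathfrak C_{d,n}|\); and if \(Kp^x<1\), then \(\mathfrak D_{d,n}\) is non-empty and \(\displaystyle 1\le \frac{|\mathfrak C_{d,n}|}{|\mathfrak D_{d,n}|}\le\frac{1+Kp^x}{1-Kp^x}.\) -/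

import Mathlib

open scoped commutatorElement

/-- The lower `p`-series `G = G_1 ≥ G_2 ≥ ⋯` of a group, `G_{i+1} = G_i ^ p [G_i, G]`, where
`G_i ^ p` is the subgroup generated by the `p`-th powers of the elements of `G_i`.
The index `0` is not used; its value is the whole group. -/
def lowerPSeries (p : ℕ) (G : Type*) [Group G] : ℕ → Subgroup G
  | 0 => ⊤
  | 1 => ⊤
  | (i + 2) =>
      Subgroup.closure ((fun x : G => x ^ p) '' (lowerPSeries p G (i + 1) : Set G)) ⊔
        ⁅lowerPSeries p G (i + 1), (⊤ : Subgroup G)⁆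

namespace lowerPSeries

variable {p : ℕ} {G : Type*} [Group G]

theorem pow_mem {i : ℕ} {x : G} (hx : x ∈ lowerPSeries p G i) :
    x ^ p ∈ lowerPSeries p G (i + 1) := by
  cases i with
  | zero => exact Subgroup.mem_top _
  | succ i =>
    exact Subgroup.mem_sup_left (Subgroup.subset_closure ⟨x, hx, rfl⟩)

theorem commutator_mem {i : ℕ} {x : G} (hx : x ∈ lowerPSeries p G i) (y : G) :
    ⁅x, y⁆ ∈ lowerPSeries p G (i + 1) := by
  cases i with
  | zero => exact Subgroup.mem_top _
  | succ i =>
    exact Subgroup.mem_sup_right (Subgroup.commutator_mem_commutator hx (Subgroup.mem_top y))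

theorem map_mem (f : G →* G) (i : ℕ) :
    ∀ x ∈ lowerPSeries p G i, f x ∈ lowerPSeries p G i := by
  induction i with
  | zero => intro x _; exact Subgroup.mem_top _
  | succ i ih =>
    cases i with
    | zero => intro x _; exact Subgroup.mem_top _
    | succ i =>
      suffices h : lowerPSeries p G (i + 2) ≤ (lowerPSeries p G (i + 2)).comap f from h
      conv_lhs => rw [lowerPSeries]
      refine sup_le ?_ ?_
      · rw [Subgroup.closure_le]
        rintro _ ⟨x, hx, rfl⟩
        have := pow_mem (ih x hx)
        simpa using this
      · rw [Subgroup.commutator_le]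
        intro x hx y _
        have := commutator_mem (ih x hx) (f y)
        simpa [Subgroup.mem_comap, map_commutatorElement] using this

instance normal (i : ℕ) : (lowerPSeries p G i).Normal :=
  ⟨fun x hx g => by simpa using map_mem (MulAut.conj g).toMonoidHom i x hx⟩

theorem succ_le (i : ℕ) : lowerPSeries p G (i + 1) ≤ lowerPSeries p G i := by
  cases i with
  | zero => exact le_top
  | succ i =>
    conv_lhs => rw [lowerPSeries]
    refine sup_le ?_ ?_
    · rw [Subgroup.closure_le]
      rintro _ ⟨x, hx, rfl⟩
      exact Subgroup.pow_mem _ hx p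
    · exact Subgroup.commutator_le_left _ _

theorem mk_comm {i : ℕ} {x : G} (hx : x ∈ lowerPSeries p G i)
    (q : G ⧸ lowerPSeries p G (i + 1)) :
    (QuotientGroup.mk x : G ⧸ lowerPSeries p G (i + 1)) * q = q * QuotientGroup.mk x := by
  induction q using QuotientGroup.induction_on with
  | H y =>
    rw [← commutatorElement_eq_one_iff_mul_comm]
    exact (QuotientGroup.eq_one_iff _).2 (commutator_mem hx y)

theorem mk_pow {i : ℕ} {x : G} (hx : x ∈ lowerPSeries p G i) :
    (QuotientGroup.mk x : G ⧸ lowerPSeries p G (i + 1)) ^ p = 1 :=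
  (QuotientGroup.eq_one_iff _).2 (pow_mem hx)

/-- Elements of `G_i` and of `G_2` commute modulo `G_{i+2}`. -/
theorem mk_comm_two {i : ℕ} {x w : G} (hx : x ∈ lowerPSeries p G i)
    (hw : w ∈ lowerPSeries p G 2) :
    (QuotientGroup.mk x : G ⧸ lowerPSeries p G (i + 2)) * QuotientGroup.mk w =
      QuotientGroup.mk w * QuotientGroup.mk x := by
  have key : ∀ y : G, ∃ c : G ⧸ lowerPSeries p G (i + 2), (∀ q, c * q = q * c) ∧ c ^ p = 1 ∧
      (QuotientGroup.mk x : G ⧸ lowerPSeries p G (i + 2)) * QuotientGroup.mk y *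
        (QuotientGroup.mk x)⁻¹ = c * QuotientGroup.mk y := by
    intro y
    refine ⟨QuotientGroup.mk ⁅x, y⁆, mk_comm (commutator_mem hx y),
      mk_pow (commutator_mem hx y), ?_⟩
    rw [← QuotientGroup.mk_mul, ← QuotientGroup.mk_inv, ← QuotientGroup.mk_mul,
      ← QuotientGroup.mk_mul]
    congr 1
    rw [commutatorElement_def]
    group
  suffices h : lowerPSeries p G 2 ≤ MonoidHom.eqLocus
      ((MulAut.conj (QuotientGroup.mk x : G ⧸ lowerPSeries p G (i + 2))).toMonoidHom.comp
        (QuotientGroup.mk' _)) (QuotientGroup.mk' _) by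
    have := h hw
    rw [← mul_inv_eq_iff_eq_mul]
    simpa [MonoidHom.eqLocus] using this
  conv_lhs => rw [lowerPSeries]
  refine sup_le ?_ ?_
  · rw [Subgroup.closure_le]
    rintro _ ⟨y, -, rfl⟩
    obtain ⟨c, hc, hcp, h⟩ := key y
    change ((MulAut.conj (QuotientGroup.mk x : G ⧸ lowerPSeries p G (i + 2))).toMonoidHom.comp
        (QuotientGroup.mk' _)) (y ^ p) = (QuotientGroup.mk' _) (y ^ p)
    rw [map_pow, map_pow]
    change ((QuotientGroup.mk x : G ⧸ lowerPSeries p G (i + 2)) * QuotientGroup.mk y *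
        (QuotientGroup.mk x)⁻¹) ^ p = _
    rw [h, Commute.mul_pow (hc (QuotientGroup.mk y)), hcp, one_mul]
    rfl
  · rw [Subgroup.commutator_le]
    intro y _ z _
    obtain ⟨c, hc, -, h⟩ := key y
    obtain ⟨e, he, -, h'⟩ := key z
    change ((MulAut.conj (QuotientGroup.mk x : G ⧸ lowerPSeries p G (i + 2))).toMonoidHom.comp
        (QuotientGroup.mk' _)) ⁅y, z⁆ = (QuotientGroup.mk' _) ⁅y, z⁆
    rw [map_commutatorElement, map_commutatorElement]
    change ⁅(QuotientGroup.mk x : G ⧸ lowerPSeries p G (i + 2)) * QuotientGroup.mk y *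
        (QuotientGroup.mk x)⁻¹, (QuotientGroup.mk x : G ⧸ lowerPSeries p G (i + 2)) *
        QuotientGroup.mk z * (QuotientGroup.mk x)⁻¹⁆ =
        ⁅(QuotientGroup.mk y : G ⧸ lowerPSeries p G (i + 2)), QuotientGroup.mk z⁆
    rw [h, h']
    generalize (QuotientGroup.mk y : G ⧸ lowerPSeries p G (i + 2)) = a
    generalize (QuotientGroup.mk z : G ⧸ lowerPSeries p G (i + 2)) = b
    rw [commutatorElement_def, commutatorElement_def]
    calc c * a * (e * b) * (c * a)⁻¹ * (e * b)⁻¹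
        = c * (a * e) * b * (a⁻¹ * c⁻¹) * (b⁻¹ * e⁻¹) := by group
      _ = c * (e * a) * b * (a⁻¹ * c⁻¹) * (b⁻¹ * e⁻¹) := by rw [he a]
      _ = c * (e * (a * b * a⁻¹)) * c⁻¹ * (b⁻¹ * e⁻¹) := by group
      _ = (e * (a * b * a⁻¹)) * c * c⁻¹ * (b⁻¹ * e⁻¹) := by rw [hc]
      _ = e * (a * b * a⁻¹ * b⁻¹) * e⁻¹ := by group
      _ = a * b * a⁻¹ * b⁻¹ := by rw [he]; group

/-- Two endomorphisms that agree modulo `G_2` agree on `G_i` modulo `G_{i+1}`. -/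
theorem mk_map_eq (f g : G →* G)
    (hfg : ∀ x, (QuotientGroup.mk (f x) : G ⧸ lowerPSeries p G 2) = QuotientGroup.mk (g x))
    (i : ℕ) : ∀ x ∈ lowerPSeries p G i,
      (QuotientGroup.mk (f x) : G ⧸ lowerPSeries p G (i + 1)) = QuotientGroup.mk (g x) := by
  have split : ∀ j (x : G),
      (QuotientGroup.mk (f x) : G ⧸ lowerPSeries p G j) = QuotientGroup.mk (g x) →
      ∃ z ∈ lowerPSeries p G j, f x = g x * z := by
    intro j x h
    exact ⟨(g x)⁻¹ * f x, QuotientGroup.eq.1 h.symm, by group⟩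
  induction i with
  | zero => intro x _; exact QuotientGroup.eq.2 (Subgroup.mem_top _)
  | succ i ih =>
    cases i with
    | zero => intro x _; exact hfg x
    | succ i =>
      suffices h : lowerPSeries p G (i + 2) ≤ MonoidHom.eqLocus
          ((QuotientGroup.mk' (lowerPSeries p G (i + 3))).comp f)
          ((QuotientGroup.mk' (lowerPSeries p G (i + 3))).comp g) from h
      conv_lhs => rw [lowerPSeries]
      refine sup_le ?_ ?_
      · rw [Subgroup.closure_le]
        rintro _ ⟨x, hx, rfl⟩
        obtain ⟨z, hz, h⟩ := split _ x (ih x hx)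
        change (QuotientGroup.mk (f (x ^ p)) : G ⧸ lowerPSeries p G (i + 3)) =
          QuotientGroup.mk (g (x ^ p))
        rw [map_pow, map_pow, h, QuotientGroup.mk_pow, QuotientGroup.mk_mul,
          Commute.mul_pow (mk_comm hz (QuotientGroup.mk (g x))).symm, mk_pow hz, mul_one]
        rfl
      · rw [Subgroup.commutator_le]
        intro x hx y _
        obtain ⟨z, hz, h⟩ := split _ x (ih x hx)
        obtain ⟨w, hw, h'⟩ := split _ y (hfg y)
        have hzc := mk_comm hz
        have hwc := mk_comm_two (map_mem g _ x hx) hw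
        change (QuotientGroup.mk' (lowerPSeries p G (i + 3))) (f ⁅x, y⁆) =
          (QuotientGroup.mk' (lowerPSeries p G (i + 3))) (g ⁅x, y⁆)
        rw [map_commutatorElement, map_commutatorElement, map_commutatorElement,
          map_commutatorElement, h, h', map_mul, map_mul]
        simp only [QuotientGroup.mk'_apply]
        generalize (QuotientGroup.mk (g x) : G ⧸ lowerPSeries p G (i + 3)) = a at *
        generalize (QuotientGroup.mk (g y) : G ⧸ lowerPSeries p G (i + 3)) = b at *
        generalize (QuotientGroup.mk z : G ⧸ lowerPSeries p G (i + 3)) = c at *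
        generalize (QuotientGroup.mk w : G ⧸ lowerPSeries p G (i + 3)) = e at *
        rw [commutatorElement_def, commutatorElement_def]
        calc a * c * (b * e) * (a * c)⁻¹ * (b * e)⁻¹
            = a * (c * (b * e)) * c⁻¹ * a⁻¹ * (b * e)⁻¹ := by group
          _ = a * (b * e * c) * c⁻¹ * a⁻¹ * (b * e)⁻¹ := by rw [hzc]
          _ = a * b * (a⁻¹ * (a * e)) * a⁻¹ * e⁻¹ * b⁻¹ := by group
          _ = a * b * (a⁻¹ * (e * a)) * a⁻¹ * e⁻¹ * b⁻¹ := by rw [hwc]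
          _ = a * b * a⁻¹ * b⁻¹ := by group

end lowerPSeries

/-- `F / F_{n+1}`, where `F` is the free group on `d` generators. -/
abbrev FreeQuot (p d n : ℕ) : Type :=
  FreeGroup (Fin d) ⧸ lowerPSeries p (FreeGroup (Fin d)) (n + 1)

/-- The subgroup `F_n / F_{n+1}` of `F / F_{n+1}`. -/
def layer (p d n : ℕ) : Subgroup (FreeQuot p d n) :=
  (lowerPSeries p (FreeGroup (Fin d)) n).map (QuotientGroup.mk' _)

theorem layer_central {p d n : ℕ} {a : FreeQuot p d n} (ha : a ∈ layer p d n)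
    (b : FreeQuot p d n) : a * b = b * a := by
  obtain ⟨x, hx, rfl⟩ := ha
  exact lowerPSeries.mk_comm hx b

/-- The set `𝒞_{d,n}` of normal subgroups of `F / F_{n+1}` that lie in `F_n / F_{n+1}`. -/
def LayerSubgroup (p d n : ℕ) : Type :=
  {N : Subgroup (FreeQuot p d n) // N.Normal ∧ N ≤ layer p d n}

/-- The endomorphism `y_j ↦ ∏ i, y_i ^ (A i j)` of the free group `F`, which induces the matrix `A`
on `F / F_2 = 𝔽_p ^ d`. -/
def freeLift {p d : ℕ} (A : Matrix (Fin d) (Fin d) (ZMod p)) :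
    FreeGroup (Fin d) →* FreeGroup (Fin d) :=
  FreeGroup.lift fun j => (List.ofFn fun i => FreeGroup.of i ^ (A i j).val).prod

/-- The endomorphism of `F / F_{n+1}` induced by an endomorphism of `F`. -/
def quotMap {p d : ℕ} (n : ℕ) (f : FreeGroup (Fin d) →* FreeGroup (Fin d)) :
    FreeQuot p d n →* FreeQuot p d n :=
  QuotientGroup.map _ _ f (lowerPSeries.map_mem f (n + 1))

theorem quotMap_mem {p d n : ℕ} (f : FreeGroup (Fin d) →* FreeGroup (Fin d))
    {a : FreeQuot p d n} (ha : a ∈ layer p d n) : quotMap n f a ∈ layer p d n := by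
  obtain ⟨x, hx, rfl⟩ := ha
  exact ⟨f x, lowerPSeries.map_mem f n x hx, rfl⟩

/-- Endomorphisms of `F` that agree on the generators modulo `F_2` induce the same map on
`F_n / F_{n+1}`: this is why matrices over `𝔽_p` act there. -/
theorem quotMap_eq {p d n : ℕ} {f g : FreeGroup (Fin d) →* FreeGroup (Fin d)}
    (h : ∀ j, (QuotientGroup.mk (f (FreeGroup.of j)) : FreeQuot p d 1) =
      QuotientGroup.mk (g (FreeGroup.of j)))
    {a : FreeQuot p d n} (ha : a ∈ layer p d n) : quotMap n f a = quotMap n g a := by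
  obtain ⟨x, hx, rfl⟩ := ha
  have hfg : (QuotientGroup.mk' (lowerPSeries p (FreeGroup (Fin d)) 2)).comp f =
      (QuotientGroup.mk' (lowerPSeries p (FreeGroup (Fin d)) 2)).comp g :=
    FreeGroup.ext_hom _ _ h
  exact lowerPSeries.mk_map_eq f g (fun y => DFunLike.congr_fun hfg y) n x hx

/-- `F / F_2` is abelian. -/
instance (p d : ℕ) : CommGroup (FreeQuot p d 1) :=
  { (inferInstance : Group (FreeQuot p d 1)) with
    mul_comm := fun a b => by
      induction a using QuotientGroup.induction_on with
      | H x => exact lowerPSeries.mk_comm (i := 1) (Subgroup.mem_top x) b }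

theorem freeLift_mk {p d : ℕ} (A : Matrix (Fin d) (Fin d) (ZMod p)) (j : Fin d) :
    (QuotientGroup.mk (freeLift A (FreeGroup.of j)) : FreeQuot p d 1) =
      ∏ i, (QuotientGroup.mk (FreeGroup.of i) : FreeQuot p d 1) ^ (A i j).val := by
  rw [freeLift, FreeGroup.lift_apply_of,
    ← QuotientGroup.mk'_apply, map_list_prod, List.map_ofFn, List.prod_ofFn]
  rfl

theorem pow_eq_pow_of_cast {p d : ℕ} (a : FreeQuot p d 1) {k l : ℕ}
    (h : (k : ZMod p) = l) : a ^ k = a ^ l := by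
  have ha : a ^ p = 1 := by
    induction a using QuotientGroup.induction_on with
    | H x => exact lowerPSeries.mk_pow (i := 1) (Subgroup.mem_top x)
  rw [pow_eq_pow_iff_modEq]
  exact ((ZMod.natCast_eq_natCast_iff _ _ _).1 h).of_dvd (orderOf_dvd_of_pow_eq_one ha)

theorem freeLift_one {p d : ℕ} [NeZero p] (j : Fin d) :
    (QuotientGroup.mk (freeLift (1 : Matrix (Fin d) (Fin d) (ZMod p)) (FreeGroup.of j)) :
      FreeQuot p d 1) = QuotientGroup.mk (FreeGroup.of j) := by
  rw [freeLift_mk, Finset.prod_eq_single j]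
  · rw [Matrix.one_apply_eq]
    conv_rhs => rw [← pow_one (QuotientGroup.mk (FreeGroup.of j) : FreeQuot p d 1)]
    exact pow_eq_pow_of_cast _ (by simp)
  · intro i _ hij
    rw [Matrix.one_apply_ne hij, ZMod.val_zero, pow_zero]
  · simp

theorem freeLift_mul {p d : ℕ} [NeZero p] (A B : Matrix (Fin d) (Fin d) (ZMod p)) (j : Fin d) :
    (QuotientGroup.mk (freeLift (A * B) (FreeGroup.of j)) : FreeQuot p d 1) =
      QuotientGroup.mk (((freeLift A).comp (freeLift B)) (FreeGroup.of j)) := by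
  have h : (QuotientGroup.mk (((freeLift A).comp (freeLift B)) (FreeGroup.of j)) :
      FreeQuot p d 1) = quotMap 1 (freeLift A) (QuotientGroup.mk (freeLift B (FreeGroup.of j))) :=
    rfl
  rw [h, freeLift_mk, freeLift_mk, map_prod]
  have h2 : ∀ k : Fin d, quotMap 1 (freeLift A)
      ((QuotientGroup.mk (FreeGroup.of k) : FreeQuot p d 1) ^ (B k j).val) =
      ∏ i, (QuotientGroup.mk (FreeGroup.of i) : FreeQuot p d 1) ^ ((A i k).val * (B k j).val) := by
    intro k
    rw [map_pow]
    change (QuotientGroup.mk (freeLift A (FreeGroup.of k)) : FreeQuot p d 1) ^ _ = _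
    rw [freeLift_mk, ← Finset.prod_pow]
    simp only [pow_mul]
  simp only [h2]
  rw [Finset.prod_comm]
  refine Finset.prod_congr rfl fun i _ => ?_
  rw [Finset.prod_pow_eq_pow_sum]
  refine pow_eq_pow_of_cast _ ?_
  simp [Matrix.mul_apply]

/-- The action of `GL(d, 𝔽_p)` on `𝒞_{d,n}`: a matrix acts on subgroups of `F_n / F_{n+1}` through
any endomorphism of `F` that induces this matrix on `F / F_2`. -/
instance (p d n : ℕ) [Fact p.Prime] :
    MulAction (Matrix.GeneralLinearGroup (Fin d) (ZMod p)) (LayerSubgroup p d n) where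
  smul g N := ⟨N.1.map (quotMap n (freeLift g.1)), by
    have hle : N.1.map (quotMap n (freeLift g.1)) ≤ layer p d n := by
      rintro _ ⟨a, ha, rfl⟩
      exact quotMap_mem _ (N.2.2 ha)
    refine ⟨⟨fun a ha b => ?_⟩, hle⟩
    rwa [← layer_central (hle ha) b, mul_inv_cancel_right]⟩
  one_smul N := by
    refine Subtype.ext (SetLike.coe_injective ?_)
    change (quotMap n (freeLift (1 : Matrix (Fin d) (Fin d) (ZMod p)))) '' (N.1 : Set (FreeQuot p d n)) = N.1
    have : ∀ a ∈ N.1, quotMap n (freeLift (1 : Matrix (Fin d) (Fin d) (ZMod p))) a = id a := by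
      intro a ha
      rw [quotMap_eq (g := MonoidHom.id _) freeLift_one (N.2.2 ha)]
      exact DFunLike.congr_fun (QuotientGroup.map_id _ _) a
    rw [Set.image_congr this, Set.image_id]
  mul_smul g h N := by
    refine Subtype.ext (SetLike.coe_injective ?_)
    change (quotMap n (freeLift (g.1 * h.1))) '' (N.1 : Set (FreeQuot p d n)) =
      (quotMap n (freeLift g.1)) '' ((quotMap n (freeLift h.1)) '' N.1)
    rw [Set.image_image]
    refine Set.image_congr fun a ha => ?_
    rw [quotMap_eq (freeLift_mul g.1 h.1) (N.2.2 ha)]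
    induction a using QuotientGroup.induction_on with
    | H x => rfl

/-- The set `ℭ_{d,n}` of `GL(d, 𝔽_p)`-orbits in `𝒞_{d,n}`. -/
abbrev LayerOrbit (p d n : ℕ) [Fact p.Prime] : Type :=
  MulAction.orbitRel.Quotient (Matrix.GeneralLinearGroup (Fin d) (ZMod p)) (LayerSubgroup p d n)

/-- The set `𝔇_{d,n}` of regular `GL(d, 𝔽_p)`-orbits in `𝒞_{d,n}`, the orbits in which every point
has trivial stabilizer. -/
def RegularLayerOrbit (p d n : ℕ) [Fact p.Prime] : Type :=
  {ω : LayerOrbit p d n // ∀ N ∈ ω.orbit,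
    MulAction.stabilizer (Matrix.GeneralLinearGroup (Fin d) (ZMod p)) N = ⊥}

theorem lowerPSeries.finiteIndex (p d i : ℕ) [Fact p.Prime] :
    (lowerPSeries p (FreeGroup (Fin d)) i).FiniteIndex := by
  induction i with
  | zero => exact (inferInstance : (⊤ : Subgroup (FreeGroup (Fin d))).FiniteIndex)
  | succ i ih =>
    let P := lowerPSeries p (FreeGroup (Fin d)) i
    let Q := (lowerPSeries p (FreeGroup (Fin d)) (i + 1)).subgroupOf P
    have hfg : Group.FG P := inferInstance
    let _ : CommGroup (P ⧸ Q) :=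
      { (inferInstance : Group (P ⧸ Q)) with
        mul_comm := fun a b => by
          induction a using QuotientGroup.induction_on with
          | H x =>
            induction b using QuotientGroup.induction_on with
            | H y =>
              rw [← commutatorElement_eq_one_iff_mul_comm]
              exact (QuotientGroup.eq_one_iff (N := Q) ⁅x, y⁆).2
                (lowerPSeries.commutator_mem x.2 (y : FreeGroup (Fin d))) }
    have hfg' : Group.FG (P ⧸ Q) := QuotientGroup.fg Q
    have htors : IsMulTorsion (P ⧸ Q) := by
      intro a
      rw [isOfFinOrder_iff_pow_eq_one]
      refine ⟨p, (Fact.out : p.Prime).pos, ?_⟩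
      induction a using QuotientGroup.induction_on with
      | H x => exact (QuotientGroup.eq_one_iff (N := Q) (x ^ p)).2 (lowerPSeries.pow_mem x.2)
    have hfin : Finite (P ⧸ Q) := CommGroup.finite_of_fg_isMulTorsion _ htors
    have h1 : (lowerPSeries p (FreeGroup (Fin d)) (i + 1)).relIndex P ≠ 0 :=
      Subgroup.index_ne_zero_of_finite (H := Q)
    refine ⟨?_⟩
    rw [← Subgroup.relIndex_mul_index (lowerPSeries.succ_le (p := p) i)]
    exact mul_ne_zero h1 ih.index_ne_zero

instance (p d n : ℕ) [Fact p.Prime] : Finite (FreeQuot p d n) :=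
  haveI := lowerPSeries.finiteIndex p d (n + 1)
  Subgroup.finite_quotient_of_finiteIndex

instance (p d n : ℕ) [Fact p.Prime] : Finite (LayerSubgroup p d n) :=
  inferInstanceAs (Finite {N : Subgroup (FreeQuot p d n) // N.Normal ∧ N ≤ layer p d n})

instance (p d n : ℕ) [Fact p.Prime] : Finite (RegularLayerOrbit p d n) :=
  inferInstanceAs (Finite {ω : LayerOrbit p d n // ∀ N ∈ ω.orbit,
    MulAction.stabilizer (Matrix.GeneralLinearGroup (Fin d) (ZMod p)) N = ⊥})

/-- The rank `d_n` of `F_n / F_{n+1}` (the minimal number of generators). -/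
noncomputable def layerRank (p d n : ℕ) [Fact p.Prime] : ℕ :=
  Group.rank (layer p d n)

/-- `C(q) = ∑_{r ∈ ℤ} q ^ (-r ^ 2)`. -/
noncomputable def thetaC (q : ℝ) : ℝ :=
  ∑' r : ℤ, q ^ (-(r ^ 2))

/-- `D(q) = ∏_{j ≥ 1} (1 - q ^ (-j))⁻¹`. -/
noncomputable def eulerD (q : ℝ) : ℝ :=
  ∏' j : ℕ, (1 - q ^ (-((j : ℤ) + 1)))⁻¹

/-- The constant `K`. -/
noncomputable def constK (p n : ℕ) : ℝ :=
  if n = 2 then thetaC p ^ 5 * eulerD p ^ 4 * (p : ℝ) ^ (17 / 4 : ℝ)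
  else thetaC p ^ 2 * eulerD p * (p : ℝ) ^ (3 / 4 : ℝ)

/-- The exponent `x`. -/
noncomputable def exponentX (p d n : ℕ) [Fact p.Prime] : ℝ :=
  if n = 2 then -(d : ℝ) else (d : ℝ) ^ 2 - (layerRank p d n : ℝ) / 2

/-! By Cauchy–Frobenius, the number of orbits times `|GL|` is the sum of the fixed-point counts, to
which the identity contributes `|𝒞|`. A point with non-trivial stabilizer is fixed by some `g ≠ 1`.
Hence both parts follow formally (`orbit_estimates`) once the sum of `|Fix g|` over `g ≠ 1` is at
most `K p^x |𝒞|`, which is `sum_natCard_fixedBy_le`.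

Put `V = F_n/F_{n+1}`, of dimension `m = d_n`, and let `G_m` be the number of its subspaces, so that
`|𝒞| = G_m`. A subgroup fixed by `g` is an invariant subspace of the operator `T` induced by `g` on
`V`, so the task is to bound the number of these.

For `n ≥ 3` it suffices that `T` is not a scalar. Then it has at most `2 G_{m-1}` invariant
subspaces (`natCard_invtSubmodule_le_of_not_scalar`). Since `G_{m-1} ≤ p^{-(m-1)/2} G_m` and `|GL| ≤
p^{d²}`, the sum is at most `2 p^{1/2} p^{d² - m/2} G_m`, and `2 ≤ C² D p^{1/4}`. That `T` is not a
scalar is seen on iterated `p`-th powers of generators and of commutators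
(`LayerSpace.exists_map_ne_smul`).

For `n = 2` that bound is too weak against `p^{d²}`, because `m` is only about `d²/2`. Here `g` is
replaced by a power of prime order, which only enlarges the fixed set. Every `T - a` has rank at
least 8 (`LayerSpace.le_finrank_range_map_sub`), and an operator of prime order with this property
has at most `p^{-2m} G_m` invariant subspaces (`natCard_invtSubmodule_mul_le_of_prime_order`). As
`2m ≥ d² + d`, summing over the group leaves `p^{-d} G_m`.

The constants `C` and `D` enter only through `C ≥ 1 + 2/p` and `D ≥ 1`. -/

/-- The number of subspaces of an `m`-dimensional vector space over a field with `q` elements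
(see `Submodule.natCard_eq_galoisNumber`). -/
def galoisNumber (q : ℕ) : ℕ → ℕ
  | 0 => 1
  | 1 => 2
  | (m + 2) => 2 * galoisNumber q (m + 1) + (q ^ (m + 1) - 1) * galoisNumber q m

/-! ### Counting subspaces over a finite field -/

section Counting

variable {K : Type*} [Field K]

theorem LinearEquiv.natCard_submodule_eq {V W : Type*} [AddCommGroup V] [Module K V]
    [AddCommGroup W] [Module K W] (e : V ≃ₗ[K] W) :
    Nat.card (Submodule K V) = Nat.card (Submodule K W) :=
  Nat.card_congr (Submodule.orderIsoMapComap e).toEquiv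

theorem natCard_submodule_eq_pi {V : Type*} [AddCommGroup V] [Module K V]
    [Module.Finite K V] :
    Nat.card (Submodule K V) = Nat.card (Submodule K (Fin (Module.finrank K V) → K)) :=
  (LinearEquiv.ofFinrankEq V _ (by simp)).natCard_submodule_eq

theorem natCard_submodule_ge {V : Type*} [AddCommGroup V] [Module K V] (S : Submodule K V) :
    Nat.card {W : Submodule K V // S ≤ W} = Nat.card (Submodule K (V ⧸ S)) :=
  (Nat.card_congr (Submodule.comapMkQRelIso S).toEquiv).symm

theorem natCard_submodule_mem {V : Type*} [AddCommGroup V] [Module K V]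
    [Module.Finite K V] {m : ℕ} (hm : Module.finrank K V = m + 1) {v : V} (hv : v ≠ 0) :
    Nat.card {W : Submodule K V // v ∈ W} = Nat.card (Submodule K (Fin m → K)) := by
  have h1 : Nat.card {W : Submodule K V // v ∈ W} =
      Nat.card {W : Submodule K V // K ∙ v ≤ W} :=
    Nat.card_congr (Equiv.subtypeEquivRight fun W => by
      rw [Submodule.span_singleton_le_iff_mem])
  have h2 : Module.finrank K (V ⧸ (K ∙ v)) = m := by
    have := Submodule.finrank_quotient_add_finrank (K ∙ v)
    rw [finrank_span_singleton hv] at this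
    omega
  rw [h1, natCard_submodule_ge, natCard_submodule_eq_pi, h2]

theorem natCard_subtype_not_le {α : Type*} [Finite α] (P : α → Prop) :
    Nat.card α = Nat.card {a // P a} + Nat.card {a // ¬ P a} := by
  classical
  rw [← Nat.card_sum]
  exact Nat.card_congr (Equiv.sumCompl P).symm

variable [Finite K]

/-- Subspaces of `V × K` that avoid the line `0 × K` are the graphs of partial functionals. -/
theorem natCard_submodule_prod_notMem {V : Type*} [AddCommGroup V] [Module K V]
    [Module.Finite K V] :
    Nat.card {W : Submodule K (V × K) // ((0 : V), (1 : K)) ∉ W} =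
      Nat.card (Σ W : Submodule K V, W) := by
  have : Finite V := Module.finite_of_finite K
  have hgr : ∀ W : Submodule K (V × K), ((0 : V), (1 : K)) ∉ W →
      ∀ x ∈ W, x.1 = 0 → x.2 = 0 := by
    rintro W hW ⟨v, a⟩ hx (rfl : v = 0)
    by_contra ha
    refine hW ?_
    have := W.smul_mem a⁻¹ hx
    simpa [inv_mul_cancel₀ (show a ≠ 0 from ha)] using this
  have e1 : {W : Submodule K (V × K) // ((0 : V), (1 : K)) ∉ W} ≃ (V →ₗ.[K] K) :=
    { toFun := fun W => W.1.toLinearPMap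
      invFun := fun f => ⟨f.graph, fun h => one_ne_zero (f.graph_fst_eq_zero_snd h rfl)⟩
      left_inv := fun W => Subtype.ext (Submodule.toLinearPMap_graph_eq _ (hgr _ W.2))
      right_inv := fun f => LinearPMap.eq_of_eq_graph
        (Submodule.toLinearPMap_graph_eq _ fun x hx h => f.graph_fst_eq_zero_snd hx h) }
  have e2 : (V →ₗ.[K] K) ≃ Σ W : Submodule K V, (W →ₗ[K] K) :=
    { toFun := fun f => ⟨f.domain, f.toFun⟩
      invFun := fun f => ⟨f.1, f.2⟩
      left_inv := fun f => rfl
      right_inv := fun f => rfl }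
  refine Nat.card_congr ((e1.trans e2).trans (Equiv.sigmaCongrRight fun W => ?_))
  exact (LinearEquiv.ofFinrankEq (Module.Dual K W) W Subspace.dual_finrank_eq).toEquiv

/-- Double counting of pairs `v ∈ W`: the zero vector lies in every subspace, and the subspaces
through a fixed non-zero vector are those of a quotient of dimension `m`. -/
theorem natCard_sigma_submodule {V : Type*} [AddCommGroup V] [Module K V]
    [Module.Finite K V] {m : ℕ} (hm : Module.finrank K V = m + 1) :
    Nat.card (Σ W : Submodule K V, W) = Nat.card (Submodule K (Fin (m + 1) → K)) +
      (Nat.card K ^ (m + 1) - 1) * Nat.card (Submodule K (Fin m → K)) := by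
  classical
  have : Finite V := Module.finite_of_finite K
  have := Fintype.ofFinite V
  have e : (Σ W : Submodule K V, W) ≃ Σ v : V, {W : Submodule K V // v ∈ W} :=
    { toFun := fun x => ⟨x.2.1, x.1, x.2.2⟩
      invFun := fun x => ⟨x.2.1, x.1, x.2.2⟩
      left_inv := fun x => rfl
      right_inv := fun x => rfl }
  rw [Nat.card_congr e, Nat.card_sigma, ← Finset.add_sum_erase _ _ (Finset.mem_univ (0 : V)),
    Finset.sum_congr rfl fun v hv => natCard_submodule_mem hm (Finset.ne_of_mem_erase hv)]
  rw [Finset.sum_const, Finset.card_erase_of_mem (Finset.mem_univ _), Finset.card_univ,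
    ← Nat.card_eq_fintype_card, Module.natCard_eq_pow_finrank (K := K) (V := V), hm, smul_eq_mul]
  congr 1
  rw [Nat.card_congr (Equiv.subtypeUnivEquiv fun W => W.zero_mem), natCard_submodule_eq_pi, hm]

/-- Split off a line. The subspaces containing it form a quotient count; the others are graphs of
functionals on subspaces `W` of the complement, and as `W` has as many functionals as vectors, they
are counted by pairs `v ∈ W`. -/
theorem natCard_submodule_pi_add_two (m : ℕ) :
    Nat.card (Submodule K (Fin (m + 2) → K)) =
      2 * Nat.card (Submodule K (Fin (m + 1) → K)) +
        (Nat.card K ^ (m + 1) - 1) * Nat.card (Submodule K (Fin m → K)) := by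
  have e : (Fin (m + 2) → K) ≃ₗ[K] (Fin (m + 1) → K) × K :=
    LinearEquiv.ofFinrankEq _ _ (by simp)
  have : Finite ((Fin (m + 1) → K) × K) := inferInstance
  rw [e.natCard_submodule_eq, natCard_subtype_not_le fun W => ((0 : Fin (m + 1) → K), (1 : K)) ∈ W,
    natCard_submodule_prod_notMem, natCard_sigma_submodule (m := m) (by simp),
    natCard_submodule_mem (m := m + 1) (by simp) (by simp)]
  ring

theorem Submodule.natCard_eq_galoisNumber {V : Type*} [AddCommGroup V] [Module K V]
    [Module.Finite K V] :
    Nat.card (Submodule K V) = galoisNumber (Nat.card K) (Module.finrank K V) := by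
  rw [natCard_submodule_eq_pi]
  generalize Module.finrank K V = m
  induction m using Nat.twoStepInduction with
  | zero =>
    rw [galoisNumber, Nat.card_eq_one_iff_unique]
    exact ⟨inferInstance, ⟨⊥⟩⟩
  | one =>
    have e : (Fin 1 → K) ≃ₗ[K] K := LinearEquiv.funUnique (Fin 1) K K
    rw [galoisNumber, e.natCard_submodule_eq]
    classical
    have e2 : Ideal K ≃ Bool := IsSimpleOrder.equivBool
    exact (Nat.card_congr e2).trans (by simp)
  | more m h1 h2 => rw [natCard_submodule_pi_add_two, galoisNumber, h1, h2]

end Counting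

/-! ### Growth of the Galois numbers -/

section GaloisNumber

theorem galoisNumber_pos (q m : ℕ) : 0 < galoisNumber q m := by
  induction m using Nat.twoStepInduction with
  | zero => simp [galoisNumber]
  | one => simp [galoisNumber]
  | more m h1 h2 => rw [galoisNumber]; positivity

theorem Nat.succ_mul_succ_div_four (m : ℕ) :
    (m + 2) * (m + 2) / 4 = m * m / 4 + (m + 1) := by
  rw [show (m + 2) * (m + 2) = m * m + 4 * (m + 1) by ring]
  omega

theorem Nat.mul_self_div_four_lt (m : ℕ) (hm : 1 ≤ m) :
    m * m / 4 + 1 ≤ (m + 1) * (m + 1) / 4 := by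
  obtain ⟨k, rfl⟩ := Nat.exists_eq_add_of_le hm
  rcases Nat.eq_zero_or_pos k with rfl | hk
  · norm_num
  rw [show (1 + k + 1) * (1 + k + 1) = k * k + 4 * k + 4 by ring,
    show (1 + k) * (1 + k) = k * k + 2 * k + 1 by ring]
  omega

theorem galoisNumber_le {q : ℕ} (hq : 2 ≤ q) (m : ℕ) :
    galoisNumber q m ≤ q ^ (m * m / 4 + m) := by
  induction m using Nat.twoStepInduction with
  | zero => simp [galoisNumber]
  | one => simpa [galoisNumber] using hq
  | more m h1 h2 =>
    rw [galoisNumber, Nat.succ_mul_succ_div_four]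
    set a := m * m / 4 + m with ha
    have h3 : (m + 1) * (m + 1) / 4 + 1 ≤ m * m / 4 + (m + 1) := by
      rw [← Nat.succ_mul_succ_div_four]
      exact Nat.mul_self_div_four_lt (m + 1) (by omega)
    have h4 : galoisNumber q (m + 1) ≤ q ^ (m * m / 4 + (m + 1) + m) :=
      h2.trans (Nat.pow_le_pow_right (by omega) (by omega))
    have h5 : (q ^ (m + 1) - 1) * galoisNumber q m ≤ q ^ (m * m / 4 + (m + 1) + m) := by
      calc _ ≤ q ^ (m + 1) * q ^ a := Nat.mul_le_mul (Nat.sub_le _ _) h1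
        _ = q ^ (m * m / 4 + (m + 1) + m) := by rw [← pow_add]; congr 1; omega
    -- Both terms of the recursion are multiples of the same power of `q`, with total coefficient `3
    -- ≤ q ^ 2`.
    calc _ ≤ 2 * q ^ (m * m / 4 + (m + 1) + m) + q ^ (m * m / 4 + (m + 1) + m) := by gcongr
      _ ≤ q ^ 2 * q ^ (m * m / 4 + (m + 1) + m) := by
        rw [← Nat.succ_mul]
        exact Nat.mul_le_mul_right _ (by nlinarith)
      _ = _ := by rw [← pow_add]; congr 1; omega

theorem le_galoisNumber {q : ℕ} (hq : 2 ≤ q) (m : ℕ) :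
    q ^ (m * m / 4) ≤ galoisNumber q m := by
  induction m using Nat.twoStepInduction with
  | zero => simp [galoisNumber]
  | one => simp [galoisNumber]
  | more m h1 h2 =>
    have h3 : galoisNumber q m ≤ galoisNumber q (m + 1) := by
      cases m with
      | zero => simp [galoisNumber]
      | succ m => rw [galoisNumber]; nlinarith [Nat.zero_le ((q ^ (m + 1) - 1) * galoisNumber q m)]
    rw [galoisNumber, Nat.succ_mul_succ_div_four, pow_add]
    have h4 : q ^ (m + 1) = (q ^ (m + 1) - 1) + 1 :=
      (Nat.sub_add_cancel (Nat.one_le_pow _ _ (by omega))).symm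
    calc q ^ (m * m / 4) * q ^ (m + 1) ≤ galoisNumber q m * ((q ^ (m + 1) - 1) + 1) := by
          rw [← h4]; gcongr
      _ ≤ _ := by
        rw [mul_add, mul_comm (galoisNumber q m)]
        omega

/-- The two bounds feed each other. With `s = √q` the recursion reads `G_{m+2} = 2 G_{m+1} +
(s^{m+1} - 1)(s^{m+1} + 1) G_m`, so the upper bound on `G_{m+1}` gives the next lower bound, and the
lower bound on `G_{m+1}` gives the next upper bound. -/
theorem galoisNumber_ratio {q : ℕ} (hq : 2 ≤ q) (m : ℕ) :
    (1 + √(q : ℝ) ^ m) * galoisNumber q m ≤ galoisNumber q (m + 1) ∧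
      (galoisNumber q (m + 1) : ℝ) ≤ (1 + √(q : ℝ) ^ (m + 1)) * galoisNumber q m := by
  set s := √(q : ℝ) with hs
  have hs2 : s ^ 2 = q := Real.sq_sqrt (by positivity)
  have hq' : (2 : ℝ) ≤ q := by exact_mod_cast hq
  have hs1 : 1 ≤ s := by rw [hs, Real.one_le_sqrt]; linarith
  induction m with
  | zero => simp only [galoisNumber]; norm_num; linarith
  | succ m ih =>
    obtain ⟨h1, h2⟩ := ih
    have hcast : (galoisNumber q (m + 2) : ℝ) =
        2 * galoisNumber q (m + 1) + ((s ^ (m + 1)) ^ 2 - 1) * galoisNumber q m := by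
      rw [galoisNumber, ← pow_mul, mul_comm (m + 1), pow_mul, hs2]
      push_cast [Nat.one_le_pow (m + 1) q (by omega)]
      ring
    rw [show m + 1 + 1 = m + 2 from rfl, hcast]
    have ht : 1 ≤ s ^ m := one_le_pow₀ hs1
    have hm : (0 : ℝ) < galoisNumber q m := by exact_mod_cast galoisNumber_pos q m
    rw [show s ^ (m + 2) = s * (s * s ^ m) by ring]
    rw [show s ^ (m + 1) = s * s ^ m by ring] at h2 ⊢
    generalize s ^ m = t at *
    generalize (galoisNumber q (m + 1) : ℝ) = b at *
    generalize (galoisNumber q m : ℝ) = a at *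
    have hst : 1 ≤ s * t := by nlinarith
    refine ⟨by nlinarith, ?_⟩
    have h4 : 0 ≤ s * (s * t) - 1 := by nlinarith
    have h5 : (s * (s * t) - 1) * ((1 + t) * a) ≤ (s * (s * t) - 1) * b := by gcongr
    have h6 : (0 : ℝ) ≤ a * (t * (s ^ 2 - 1)) := by
      have : 0 ≤ s ^ 2 - 1 := by nlinarith
      positivity
    nlinarith

/-- Log-convexity: for `a < b` the ratio at `a` is at most `1 + s^{a+1} ≤ 1 + s^b`, which is at most
the ratio at `b`. -/
theorem galoisNumber_mul_le {q : ℕ} (hq : 2 ≤ q) {a b : ℕ} (hab : a ≤ b) :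
    galoisNumber q (a + 1) * galoisNumber q b ≤ galoisNumber q a * galoisNumber q (b + 1) := by
  rcases hab.eq_or_lt with rfl | hab
  · rw [mul_comm]
  have h1 := (galoisNumber_ratio hq a).2
  have h2 := (galoisNumber_ratio hq b).1
  have hs1 : 1 ≤ √(q : ℝ) := by
    rw [Real.one_le_sqrt]
    exact_mod_cast (by omega : 1 ≤ q)
  have h3 : √(q : ℝ) ^ (a + 1) ≤ √(q : ℝ) ^ b := pow_le_pow_right₀ hs1 hab
  have : (galoisNumber q (a + 1) : ℝ) * galoisNumber q b ≤
      galoisNumber q a * galoisNumber q (b + 1) := by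
    calc (galoisNumber q (a + 1) : ℝ) * galoisNumber q b
        ≤ (1 + √(q : ℝ) ^ (a + 1)) * galoisNumber q a * galoisNumber q b := by gcongr
      _ ≤ (1 + √(q : ℝ) ^ b) * galoisNumber q a * galoisNumber q b := by gcongr
      _ = galoisNumber q a * ((1 + √(q : ℝ) ^ b) * galoisNumber q b) := by ring
      _ ≤ _ := by gcongr
  exact_mod_cast this

/-- By log-convexity the product grows when dimension is moved from the smaller factor to the larger
one; at the end the smaller factor is `G_1 = 2`. -/
theorem galoisNumber_mul_le_two_mul {q : ℕ} (hq : 2 ≤ q) {a b : ℕ} (ha : 1 ≤ a) (hb : 1 ≤ b) :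
    galoisNumber q a * galoisNumber q b ≤ 2 * galoisNumber q (a + b - 1) := by
  wlog hab : a ≤ b generalizing a b
  · rw [mul_comm, add_comm]
    exact this hb ha (by omega)
  induction a, ha using Nat.le_induction generalizing b with
  | base => simp [galoisNumber]
  | succ a ha ih =>
    calc _ ≤ galoisNumber q a * galoisNumber q (b + 1) := galoisNumber_mul_le hq (by omega)
      _ ≤ 2 * galoisNumber q (a + (b + 1) - 1) := ih (by omega) (by omega)
      _ = _ := by congr 2; omega

end GaloisNumber

/-! ### Invariant subspaces of a single operator -/

section InvariantSubspaces

open Polynomial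

variable {K : Type*} [Field K] {V : Type*} [AddCommGroup V] [Module K V]

theorem Module.End.invtSubmodule_aeval {T : Module.End K V} {W : Submodule K V}
    (hW : W ∈ T.invtSubmodule) (Q : K[X]) : W ∈ (aeval T Q).invtSubmodule := by
  rw [Module.End.mem_invtSubmodule] at hW ⊢
  induction Q using Polynomial.induction_on' with
  | add a b ha hb =>
    intro x hx
    simpa using W.add_mem (ha hx) (hb hx)
  | monomial n a =>
    intro x hx
    have : ∀ n : ℕ, (T ^ n) x ∈ W := by
      intro n
      induction n with
      | zero => simpa using hx
      | succ n ih => rw [pow_succ']; exact hW ih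
    simpa [aeval_monomial, Algebra.algebraMap_eq_smul_one] using W.smul_mem a (this n)

theorem Submodule.finrank_comap_le [Module.Finite K V] (N : Module.End K V) (W : Submodule K V) :
    Module.finrank K (W.comap N) ≤ Module.finrank K W + Module.finrank K N.ker := by
  have hmap : ∀ x : W.comap N, (N.domRestrict (W.comap N)) x ∈ W := fun x => x.2
  let C : W.comap N →ₗ[K] W := (N.domRestrict (W.comap N)).codRestrict W hmap
  have h1 := C.finrank_range_add_finrank_ker
  have h2 : Module.finrank K C.range ≤ Module.finrank K W := Submodule.finrank_le _
  have h3 : Module.finrank K C.ker ≤ Module.finrank K N.ker := by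
    have hinj : ∀ x : C.ker, (((W.comap N).subtype ∘ₗ C.ker.subtype) x) ∈ N.ker :=
      fun x => congrArg Subtype.val x.2
    refine LinearMap.finrank_le_finrank_of_injective
      (f := ((W.comap N).subtype ∘ₗ C.ker.subtype).codRestrict N.ker hinj) ?_
    intro x y hxy
    exact Subtype.ext (Subtype.ext (Subtype.ext_iff.1 hxy :))
  omega

theorem LinearMap.finrank_ker_mul_le [Module.Finite K V] (A B : Module.End K V) :
    Module.finrank K (A * B).ker ≤ Module.finrank K A.ker + Module.finrank K B.ker :=
  Submodule.finrank_comap_le B A.ker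

/-- Build `P` up one irreducible factor at a time. The kernel dimension first reaches 8 at some
factor `f`; unless it jumps there because `ker f(T)` is almost everything, it or `ker f(T)` itself
lies between 8 and `m - 8`. The bound 22 is `7 + 7 + 8`: two kernels of dimension at most 7 must
still leave codimension 8. -/
theorem exists_finrank_ker_aeval [Module.Finite K V] (T : Module.End K V)
    (hm : 22 ≤ Module.finrank K V) (P : K[X]) (hP : P ≠ 0)
    (h8 : 8 ≤ Module.finrank K (aeval T P).ker) :
    (∃ Q : K[X], 8 ≤ Module.finrank K (aeval T Q).ker ∧
      Module.finrank K (aeval T Q).ker + 8 ≤ Module.finrank K V) ∨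
    ∃ f : K[X], Irreducible f ∧ f ∣ P ∧
      Module.finrank K V ≤ Module.finrank K (aeval T f).ker + 7 := by
  induction P using WfDvdMonoid.induction_on_irreducible with
  | zero => exact absurd rfl hP
  | unit u hu =>
    have : (aeval T u).ker = ⊥ := by
      have := hu.map (aeval T)
      rw [LinearMap.ker_eq_bot]
      exact ((Module.End.isUnit_iff _).1 this).injective
    rw [this, finrank_bot] at h8
    omega
  | mul P f hP0 hf ih =>
    by_cases h1 : 8 ≤ Module.finrank K (aeval T P).ker
    · rcases ih hP0 h1 with h | ⟨g, hg, hgP, h⟩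
      · exact Or.inl h
      · exact Or.inr ⟨g, hg, hgP.mul_left f, h⟩
    · have h2 := LinearMap.finrank_ker_mul_le (aeval T f) (aeval T P)
      rw [← map_mul] at h2
      by_cases h3 : Module.finrank K V ≤ Module.finrank K (aeval T f).ker + 7
      · exact Or.inr ⟨f, hf, dvd_mul_right _ _, h3⟩
      · by_cases h4 : 8 ≤ Module.finrank K (aeval T f).ker
        · exact Or.inl ⟨f, h4, by omega⟩
        · exact Or.inl ⟨f * P, h8, by omega⟩

variable [Finite K]

theorem natCard_submodule_Icc_le [Module.Finite K V] {A B : Submodule K V} (hAB : A ≤ B) :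
    Nat.card {W : Submodule K V // A ≤ W ∧ W ≤ B} ≤
      galoisNumber (Nat.card K) (Module.finrank K B - Module.finrank K A) := by
  have : Finite V := Module.finite_of_finite K
  have h1 : Module.finrank K (B ⧸ A.submoduleOf B) =
      Module.finrank K B - Module.finrank K A := by
    have h2 := Submodule.finrank_quotient_add_finrank (A.submoduleOf B)
    rw [(Submodule.submoduleOfEquivOfLe hAB).finrank_eq] at h2
    omega
  rw [← h1, ← Submodule.natCard_eq_galoisNumber, ← natCard_submodule_ge]
  refine Nat.card_le_card_of_injective
    (fun W => ⟨W.1.submoduleOf B, fun x hx => W.2.1 hx⟩) ?_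
  intro W₁ W₂ h
  have h2 := congrArg (Submodule.map B.subtype) (congrArg Subtype.val h)
  simp only [Submodule.submoduleOf, Submodule.map_comap_subtype] at h2
  rw [inf_eq_right.2 W₁.2.2, inf_eq_right.2 W₂.2.2] at h2
  exact Subtype.ext h2

theorem galoisNumber_mono {q : ℕ} {a b : ℕ} (hab : a ≤ b) :
    galoisNumber q a ≤ galoisNumber q b := by
  refine monotone_nat_of_le_succ (fun m => ?_) hab
  cases m with
  | zero => simp [galoisNumber]
  | succ m => rw [galoisNumber]; nlinarith [Nat.zero_le ((q ^ (m + 1) - 1) * galoisNumber q m)]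

theorem natCard_submodule_le [Module.Finite K V] (B : Submodule K V) :
    Nat.card {W : Submodule K V // W ≤ B} = galoisNumber (Nat.card K) (Module.finrank K B) := by
  rw [← Submodule.natCard_eq_galoisNumber]
  exact Nat.card_congr (Submodule.mapIic B).symm.toEquiv

/-- An `N`-invariant subspace `W` lies between `N W` and the preimage of `N W`. -/
theorem natCard_invtSubmodule_le [Module.Finite K V] (N : Module.End K V) :
    Nat.card N.invtSubmodule ≤ galoisNumber (Nat.card K) (Module.finrank K N.ker) *
      galoisNumber (Nat.card K) (Module.finrank K N.range) := by
  classical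
  have : Finite V := Module.finite_of_finite K
  have := Fintype.ofFinite (Submodule K V)
  let s : Finset (Submodule K V) := Finset.univ.filter fun W => W ∈ N.invtSubmodule
  let t : Finset (Submodule K V) := Finset.univ.filter fun W => W ≤ N.range
  have hs : Nat.card N.invtSubmodule = s.card :=
    Nat.subtype_card s (by simp [s])
  have ht : galoisNumber (Nat.card K) (Module.finrank K N.range) = t.card := by
    rw [← natCard_submodule_le, Nat.card_eq_fintype_card, Fintype.card_subtype]
  rw [hs, ht]
  refine Finset.card_le_mul_card_image_of_maps_to (f := fun W => W.map N) ?_ _ ?_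
  · intro W _
    simpa [t] using LinearMap.map_le_range
  · intro W' _
    by_cases hW' : W' ≤ W'.comap N
    · have h1 := natCard_submodule_Icc_le hW'
      rw [Nat.card_eq_fintype_card, Fintype.card_subtype] at h1
      refine (Finset.card_le_card ?_).trans (h1.trans (galoisNumber_mono ?_))
      · intro W hW
        simp only [s, Finset.mem_filter, Finset.mem_univ, true_and,
          Module.End.mem_invtSubmodule] at hW ⊢
        obtain ⟨h2, rfl⟩ := hW
        exact ⟨Submodule.map_le_iff_le_comap.2 h2, Submodule.le_comap_map _ _⟩
      · have := Submodule.finrank_comap_le N W'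
        omega
    · rw [Finset.card_eq_zero.2]
      · exact Nat.zero_le _
      · rw [Finset.filter_eq_empty_iff]
        rintro W hW rfl
        refine hW' ?_
        simp only [s, Finset.mem_filter, Finset.mem_univ, true_and,
          Module.End.mem_invtSubmodule] at hW
        rw [← Submodule.map_le_iff_le_comap]
        exact Submodule.map_mono (Submodule.map_le_iff_le_comap.2 hW)

theorem natCard_invtSubmodule_le_aeval [Module.Finite K V] (T : Module.End K V) (Q : K[X]) :
    Nat.card T.invtSubmodule ≤
      galoisNumber (Nat.card K) (Module.finrank K (aeval T Q).ker) *
      galoisNumber (Nat.card K) (Module.finrank K (aeval T Q).range) := by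
  have : Finite V := Module.finite_of_finite K
  refine le_trans ?_ (natCard_invtSubmodule_le (aeval T Q))
  refine Nat.card_le_card_of_injective
    (fun W => ⟨W.1, Module.End.invtSubmodule_aeval W.2 Q⟩) ?_
  intro W₁ W₂ h
  exact Subtype.ext (Subtype.ext_iff.1 h :)

theorem Nat.card_ge_two_of_field : 2 ≤ Nat.card K :=
  Finite.one_lt_card

/-- If `T` has no eigenvector and `v ≠ 0`, an invariant subspace `W` that does not contain `v` is
determined by `W + ⟨v⟩`. -/
theorem natCard_invtSubmodule_le_of_forall_ne [Module.Finite K V] (T : Module.End K V) {m : ℕ}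
    (hm : Module.finrank K V = m + 1) (hT : ∀ (a : K) (x : V), T x = a • x → x = 0) :
    Nat.card T.invtSubmodule ≤ 2 * galoisNumber (Nat.card K) m := by
  have : Finite V := Module.finite_of_finite K
  have : Nontrivial V := Module.nontrivial_of_finrank_pos (R := K) (by omega)
  obtain ⟨v, hv⟩ := exists_ne (0 : V)
  have h1 : Nat.card {W : Submodule K V // v ∈ W} = galoisNumber (Nat.card K) m := by
    rw [natCard_submodule_mem hm hv, Submodule.natCard_eq_galoisNumber, Module.finrank_fin_fun]
  rw [natCard_subtype_not_le fun W : T.invtSubmodule => v ∈ W.1, two_mul, ← h1]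
  refine Nat.add_le_add ?_ ?_
  · refine Nat.card_le_card_of_injective (fun W => ⟨W.1.1, W.2⟩) ?_
    intro W₁ W₂ h
    exact Subtype.ext (Subtype.ext (Subtype.ext_iff.1 h :))
  · refine Nat.card_le_card_of_injective
      (fun W => ⟨W.1.1 ⊔ K ∙ v, Submodule.mem_sup_right (Submodule.mem_span_singleton_self v)⟩) ?_
    suffices key : ∀ W₁ ∈ T.invtSubmodule, ∀ W₂ ∈ T.invtSubmodule, v ∉ W₁ → v ∉ W₂ →
        W₁ ⊔ K ∙ v = W₂ ⊔ K ∙ v → W₁ ≤ W₂ by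
      intro W₁ W₂ h
      have h' := congrArg Subtype.val h
      exact Subtype.ext (Subtype.ext (le_antisymm
        (key _ W₁.1.2 _ W₂.1.2 W₁.2 W₂.2 h') (key _ W₂.1.2 _ W₁.1.2 W₂.2 W₁.2 h'.symm)))
    intro W₁ hW₁ W₂ hW₂ hv₁ hv₂ h w hw
    by_contra hw₂
    rw [Module.End.mem_invtSubmodule] at hW₁ hW₂
    have hw' : w ∈ W₂ ⊔ K ∙ v := h ▸ Submodule.mem_sup_left hw
    obtain ⟨y, hy, z, hz, hyz⟩ := Submodule.mem_sup.1 hw'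
    obtain ⟨c, rfl⟩ := Submodule.mem_span_singleton.1 hz
    have hc : c ≠ 0 := by
      rintro rfl
      rw [zero_smul, add_zero] at hyz
      exact hw₂ (hyz ▸ hy)
    -- Since `w ∈ W₁` and `y ∈ W₂`, this places `T v` in the common sum `X = W₁ + ⟨v⟩ = W₂ + ⟨v⟩`.
    -- Writing `T v = u + a v` with `u ∈ W₁`, the operator `T - a` maps `X` into the strictly
    -- smaller `W₁`, so it kills a non-zero vector.
    have hv' : v = c⁻¹ • (w - y) := by
      rw [← hyz, add_sub_cancel_left, inv_smul_smul₀ hc]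
    have hTv : T v ∈ W₁ ⊔ K ∙ v := by
      rw [hv', map_smul, map_sub]
      refine Submodule.smul_mem _ _ (Submodule.sub_mem _ (Submodule.mem_sup_left (hW₁ hw)) ?_)
      rw [← hv', h]
      exact Submodule.mem_sup_left (hW₂ hy)
    obtain ⟨u, hu, z, hz, huz⟩ := Submodule.mem_sup.1 hTv
    obtain ⟨a, rfl⟩ := Submodule.mem_span_singleton.1 hz
    set X := W₁ ⊔ K ∙ v with hX
    have hmap : ∀ x : X, ((T - a • 1).domRestrict X) x ∈ W₁ := by
      rintro ⟨x, hx⟩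
      obtain ⟨x₁, hx₁, z, hz, rfl⟩ := Submodule.mem_sup.1 hx
      obtain ⟨b, rfl⟩ := Submodule.mem_span_singleton.1 hz
      have : (T - a • 1) (x₁ + b • v) = T x₁ - a • x₁ + b • u := by
        have : T v = u + a • v := huz.symm
        simp [this, smul_add, smul_smul, mul_comm b a]
        abel
      simp only [LinearMap.domRestrict_apply, this]
      exact W₁.add_mem (W₁.sub_mem (hW₁ hx₁) (W₁.smul_mem _ hx₁)) (W₁.smul_mem _ hu)
    have hlt : Module.finrank K W₁ < Module.finrank K X := by
      refine Submodule.finrank_lt_finrank_of_lt (lt_of_le_of_ne le_sup_left fun h0 => hv₁ ?_)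
      rw [h0]
      exact Submodule.mem_sup_right (Submodule.mem_span_singleton_self v)
    have hker := LinearMap.ker_ne_bot_of_finrank_lt
      (f := ((T - a • 1).domRestrict X).codRestrict W₁ hmap) hlt
    obtain ⟨x, hx, hx0⟩ := (Submodule.ne_bot_iff _).1 hker
    refine hx0 (Subtype.ext (hT a x ?_))
    have hx' := congrArg Subtype.val hx
    have hx2 : (T - a • 1) (x : V) = 0 := hx'
    simpa [sub_eq_zero] using hx2

/-- If `T` has an eigenvalue `a`, then `T - a` has non-zero kernel and non-zero range, and the
product bound for these two dimensions is at most `2 G_{m-1}`. If it has none, the bound for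
operators without eigenvectors applies. -/
theorem natCard_invtSubmodule_le_of_not_scalar [Module.Finite K V] (T : Module.End K V)
    (hT : ∀ a : K, ∃ x, T x ≠ a • x) :
    Nat.card T.invtSubmodule ≤ 2 * galoisNumber (Nat.card K) (Module.finrank K V - 1) := by
  by_cases h : ∀ (a : K) (x : V), T x = a • x → x = 0
  · obtain ⟨x, hx⟩ := hT 0
    have : Nontrivial V := ⟨T x, _, hx⟩
    have := Module.finrank_pos (R := K) (M := V)
    exact natCard_invtSubmodule_le_of_forall_ne T (by omega) h
  · push Not at h
    obtain ⟨a, x, hx, hx0⟩ := h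
    obtain ⟨y, hy⟩ := hT a
    have haev : ∀ z, (aeval T (X - C a : K[X])) z = T z - a • z := by
      intro z
      simp [Algebra.algebraMap_eq_smul_one]
    have h1 := natCard_invtSubmodule_le_aeval T (X - C a)
    set N := aeval T (X - C a : K[X]) with hN
    have h2 : 1 ≤ Module.finrank K N.ker := by
      rw [Nat.one_le_iff_ne_zero, Ne, Submodule.finrank_eq_zero, Submodule.eq_bot_iff]
      push Not
      exact ⟨x, by simp [haev, hx], hx0⟩
    have h3 : 1 ≤ Module.finrank K N.range := by
      rw [Nat.one_le_iff_ne_zero, Ne, Submodule.finrank_eq_zero, Submodule.eq_bot_iff]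
      push Not
      exact ⟨N y, ⟨y, rfl⟩, by rw [haev]; exact sub_ne_zero.2 hy⟩
    have h4 := N.finrank_range_add_finrank_ker
    refine h1.trans ((galoisNumber_mul_le_two_mul Nat.card_ge_two_of_field h2 h3).trans ?_)
    rw [← h4, add_comm]

end InvariantSubspaces

/-! ### Operators of prime order -/

section PrimeOrder

open Polynomial

variable {K : Type*} [Field K] {V : Type*} [AddCommGroup V] [Module K V]

/-- Through `φ` the space becomes an `L`-space, and the subspaces in question are `L`-subspaces. The
dimension `t` is recorded by cardinality, from which the degree formula can be read off. -/
theorem natCard_submodule_le_of_ringHom [Finite V] {L : Type*} [Field L] [Finite L]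
    (φ : L →+* Module.End K V) :
    ∃ t, Nat.card L ^ t = Nat.card V ∧
      Nat.card {W : Submodule K V // ∀ a, W ≤ W.comap (φ a)} ≤ galoisNumber (Nat.card L) t := by
  let _ : Module L V := Module.compHom V φ
  have hsmul : ∀ (a : L) (x : V), a • x = φ a x := fun _ _ => rfl
  have : Module.Finite L V := Module.Finite.of_finite
  refine ⟨Module.finrank L V, Module.natCard_eq_pow_finrank.symm, ?_⟩
  rw [← Submodule.natCard_eq_galoisNumber]
  refine Nat.card_le_card_of_injective (fun W =>
    { carrier := W.1
      add_mem' := fun ha hb => W.1.add_mem ha hb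
      zero_mem' := W.1.zero_mem
      smul_mem' := fun a x hx => W.2 a hx : Submodule L V }) ?_
  intro W₁ W₂ h
  refine Subtype.ext (SetLike.coe_injective ?_)
  exact congrArg (fun S : Submodule L V => (S : Set V)) h

theorem natCard_adjoinRoot {f : K[X]} (hf : f ≠ 0) :
    Nat.card (AdjoinRoot f) = Nat.card K ^ f.natDegree := by
  have := (AdjoinRoot.powerBasis hf).finite
  rw [Module.natCard_eq_pow_finrank (K := K), (AdjoinRoot.powerBasis hf).finrank,
    AdjoinRoot.powerBasis_dim]

variable [Finite K]

/-- When an irreducible polynomial of degree at least `2` annihilates `T`, the invariant subspaces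
of `T` are subspaces over a larger field, so that there are few of them. -/
theorem natCard_invtSubmodule_le_of_irreducible [Module.Finite K V] (T : Module.End K V)
    {f : K[X]} (hf : Irreducible f) (hdeg : 2 ≤ f.natDegree) (hT : aeval T f = 0) :
    Nat.card T.invtSubmodule ≤
      Nat.card K ^ (Module.finrank K V * Module.finrank K V / 8 + Module.finrank K V) := by
  have : Finite V := Module.finite_of_finite K
  have : Fact (Irreducible f) := ⟨hf⟩
  have hq : 2 ≤ Nat.card K := Nat.card_ge_two_of_field
  have hcard := natCard_adjoinRoot hf.ne_zero
  have : Finite (AdjoinRoot f) :=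
    Nat.finite_of_card_ne_zero (by rw [hcard]; exact pow_ne_zero _ (by omega))
  let φ : AdjoinRoot f →+* Module.End K V :=
    Ideal.Quotient.lift (Ideal.span {f}) (aeval T : K[X] →ₐ[K] Module.End K V).toRingHom (by
      intro a ha
      obtain ⟨b, rfl⟩ := Ideal.mem_span_singleton'.1 ha
      simp [hT])
  have hφ : ∀ Q : K[X], φ (AdjoinRoot.mk f Q) = aeval T Q := fun Q => rfl
  obtain ⟨t, ht, hle⟩ := natCard_submodule_le_of_ringHom φ
  rw [hcard, ← pow_mul, Module.natCard_eq_pow_finrank (K := K) (V := V)] at ht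
  have ht' := Nat.pow_right_injective hq ht
  rw [← ht']
  set k := f.natDegree
  have h1 : Nat.card T.invtSubmodule ≤
      Nat.card {W : Submodule K V // ∀ a, W ≤ W.comap (φ a)} := by
    refine Nat.card_le_card_of_injective (fun W => ⟨W.1, fun a => ?_⟩) ?_
    · obtain ⟨Q, rfl⟩ := AdjoinRoot.mk_surjective a
      rw [hφ]
      exact (Module.End.mem_invtSubmodule _).1 (Module.End.invtSubmodule_aeval W.2 Q)
    · intro W₁ W₂ h
      exact Subtype.ext (Subtype.ext_iff.1 h :)
  have hq2 : 2 ≤ Nat.card (AdjoinRoot f) := Nat.card_ge_two_of_field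
  refine h1.trans (hle.trans ((galoisNumber_le hq2 t).trans ?_))
  rw [hcard, ← pow_mul]
  refine Nat.pow_le_pow_right (by omega) ?_
  rw [mul_add]
  gcongr
  rw [Nat.le_div_iff_mul_le (by norm_num)]
  have h2 : t * t / 4 * 4 ≤ t * t := Nat.div_mul_le_self _ _
  -- Here `m = k t`, and `2k ≤ k²` halves the quadratic term of the exponent.
  calc k * (t * t / 4) * 8 = 2 * k * (t * t / 4 * 4) := by ring
    _ ≤ k * k * (t * t) := Nat.mul_le_mul (Nat.mul_le_mul_right _ hdeg) h2
    _ = _ := by ring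

/-- By Bézout an invariant `W` is recovered from its intersections with `ker f(T)` and `ker g(T)`.
The first is invariant under an operator killed by `f`; for the second, of small dimension in the
application, arbitrary subspaces are counted. -/
theorem natCard_invtSubmodule_le_of_isCoprime [Module.Finite K V] (T : Module.End K V)
    {f g : K[X]} (hf : Irreducible f) (hdeg : 2 ≤ f.natDegree) (hfg : IsCoprime f g)
    (hT : aeval T (f * g) = 0) {a b : ℕ} (ha : Module.finrank K (aeval T f).ker = a)
    (hb : Module.finrank K V = a + b) :
    Nat.card T.invtSubmodule ≤ Nat.card K ^ (a * a / 8 + a) * Nat.card K ^ (b * b / 4 + b) := by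
  have : Finite V := Module.finite_of_finite K
  have hcompl : IsCompl (aeval T f).ker (aeval T g).ker := by
    refine ⟨disjoint_ker_aeval_of_isCoprime T hfg, codisjoint_iff.2 ?_⟩
    rw [sup_ker_aeval_eq_ker_aeval_mul_of_coprime T hfg, hT, LinearMap.ker_zero]
  have hb' : Module.finrank K (aeval T g).ker = b := by
    have := Submodule.finrank_add_eq_of_isCompl hcompl
    omega
  have hcomm : ∀ (P Q : K[X]) (x : V), aeval T P (aeval T Q x) = aeval T (P * Q) x := by
    intro P Q x
    rw [map_mul]
    rfl
  have hX' : ∀ x, aeval T (X : K[X]) x = T x := fun x => by rw [aeval_X]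
  have hker : ∀ x ∈ (aeval T f).ker, T x ∈ (aeval T f).ker := by
    intro x hx
    rw [LinearMap.mem_ker] at hx ⊢
    rw [← hX' x, hcomm, mul_comm, ← hcomm, hx, map_zero]
  let S : Module.End K (aeval T f).ker := T.restrict hker
  have hS : ∀ (Q : K[X]) (x : (aeval T f).ker), ((aeval S Q x : (aeval T f).ker) : V) =
      aeval T Q x := by
    intro Q x
    induction Q using Polynomial.induction_on' with
    | add P Q hP hQ => simp [hP, hQ]
    | monomial n c =>
      have : ∀ n : ℕ, (((S ^ n) x : (aeval T f).ker) : V) = (T ^ n) x := by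
        intro n
        induction n with
        | zero => rfl
        | succ n ih => rw [pow_succ', pow_succ', Module.End.mul_apply, Module.End.mul_apply, ← ih]; rfl
      simp [aeval_monomial, Algebra.algebraMap_eq_smul_one, this]
  have hSf : aeval S f = 0 := by
    refine LinearMap.ext fun x => Subtype.ext ?_
    rw [hS]
    exact x.2
  have h1 := natCard_invtSubmodule_le_of_irreducible S hf hdeg hSf
  have h2 := galoisNumber_le (Nat.card_ge_two_of_field (K := K)) b
  rw [ha] at h1
  rw [← hb', ← Submodule.natCard_eq_galoisNumber, hb'] at h2
  refine le_trans ?_ (Nat.mul_le_mul h1 h2)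
  rw [← Nat.card_prod]
  have hinv : ∀ W ∈ T.invtSubmodule, W.comap (aeval T f).ker.subtype ∈ S.invtSubmodule := by
    intro W hW
    rw [Module.End.mem_invtSubmodule] at hW ⊢
    intro x hx
    exact hW hx
  refine Nat.card_le_card_of_injective (fun W =>
    (⟨W.1.comap (aeval T f).ker.subtype, hinv _ W.2⟩, W.1.comap (aeval T g).ker.subtype)) ?_
  suffices key : ∀ W₁ ∈ T.invtSubmodule, ∀ W₂ ∈ T.invtSubmodule,
      W₁.comap (aeval T f).ker.subtype = W₂.comap (aeval T f).ker.subtype →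
      W₁.comap (aeval T g).ker.subtype = W₂.comap (aeval T g).ker.subtype → W₁ ≤ W₂ by
    intro W₁ W₂ h
    have hl := Subtype.ext_iff.1 (congrArg Prod.fst h)
    have hr := congrArg Prod.snd h
    exact Subtype.ext (le_antisymm (key _ W₁.2 _ W₂.2 hl hr) (key _ W₂.2 _ W₁.2 hl.symm hr.symm))
  intro W₁ hW₁ W₂ hW₂ hl hr x hx
  obtain ⟨u, v, huv⟩ := hfg
  have hmem : ∀ Q : K[X], aeval T Q x ∈ W₁ := fun Q =>
    (Module.End.mem_invtSubmodule _).1 (Module.End.invtSubmodule_aeval hW₁ Q) hx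
  have hxeq : x = aeval T (u * f) x + aeval T (v * g) x := by
    rw [← LinearMap.add_apply, ← map_add, huv, map_one]
    rfl
  have hzero : ∀ Q : K[X], aeval T (f * g * Q) x = 0 := by
    intro Q
    rw [map_mul, hT, zero_mul]
    rfl
  rw [hxeq]
  refine W₂.add_mem ?_ ?_
  · have h3 : aeval T (u * f) x ∈ (aeval T g).ker := by
      rw [LinearMap.mem_ker, hcomm, ← hzero u]
      congr 2
      ring
    have h4 : (⟨_, h3⟩ : (aeval T g).ker) ∈ W₁.comap (aeval T g).ker.subtype := hmem _
    rw [hr] at h4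
    exact h4
  · have h3 : aeval T (v * g) x ∈ (aeval T f).ker := by
      rw [LinearMap.mem_ker, hcomm, ← hzero v]
      congr 2
      ring
    have h4 : (⟨_, h3⟩ : (aeval T f).ker) ∈ W₁.comap (aeval T f).ker.subtype := hmem _
    rw [hl] at h4
    exact h4

/-- An operator of prime order, no shift of which by a scalar has small rank, has few invariant
subspaces. -/
theorem natCard_invtSubmodule_mul_le_of_prime_order {p : ℕ} [Fact p.Prime] {V : Type*}
    [AddCommGroup V] [Module (ZMod p) V] [Module.Finite (ZMod p) V]
    (hm : 55 ≤ Module.finrank (ZMod p) V) (T : Module.End (ZMod p) V) {l : ℕ} (hl : l.Prime)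
    (hTl : T ^ l = 1)
    (hrank : ∀ a : ZMod p, 8 ≤ Module.finrank (ZMod p) (T - a • 1).range) :
    Nat.card T.invtSubmodule * p ^ (2 * Module.finrank (ZMod p) V) ≤
      galoisNumber p (Module.finrank (ZMod p) V) := by
  have hp2 : 2 ≤ p := (Fact.out : p.Prime).two_le
  have hcard : Nat.card (ZMod p) = p := Nat.card_zmod p
  have hP : aeval T (X ^ l - 1 : (ZMod p)[X]) = 0 := by simp [hTl]
  have hP0 : (X ^ l - 1 : (ZMod p)[X]) ≠ 0 := by
    simpa using X_pow_sub_C_ne_zero hl.pos (1 : ZMod p)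
  set m := Module.finrank (ZMod p) V with hmdef
  refine le_trans ?_ (le_galoisNumber hp2 m)
  have hker : Module.finrank (ZMod p) (aeval T (X ^ l - 1 : (ZMod p)[X])).ker = m := by
    rw [hP, LinearMap.ker_zero, finrank_top]
  rcases exists_finrank_ker_aeval T (by omega) _ hP0 (by omega) with
    ⟨Q, hQ1, hQ2⟩ | ⟨f, hf, hfP, hfm⟩
  · have h1 := natCard_invtSubmodule_le_aeval T Q
    have h2 := (aeval T Q).finrank_range_add_finrank_ker
    rw [hcard] at h1
    rw [← hmdef] at h2 hQ2
    generalize Module.finrank (ZMod p) (aeval T Q).ker = r at *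
    generalize Module.finrank (ZMod p) (aeval T Q).range = s at *
    calc _ ≤ p ^ (r * r / 4 + r) * p ^ (s * s / 4 + s) * p ^ (2 * m) := by
          gcongr
          exact h1.trans (Nat.mul_le_mul (galoisNumber_le hp2 r) (galoisNumber_le hp2 s))
      _ = p ^ (r * r / 4 + r + (s * s / 4 + s) + 2 * m) := by rw [← pow_add, ← pow_add]
      _ ≤ _ := by
        refine Nat.pow_le_pow_right (by omega) ?_
        -- Up to rounding, the exponents compare when `6(r + s) ≤ r s`, that is, `(r - 6)(s - 6) ≥
        -- 36`. This holds because `r, s ≥ 8` and `r + s = m ≥ 55`.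
        obtain ⟨u, rfl⟩ := Nat.exists_eq_add_of_le hQ1
        obtain ⟨v, rfl⟩ := Nat.exists_eq_add_of_le (show 8 ≤ s by omega)
        rw [← h2]
        ring_nf
        have := Nat.zero_le (u * v)
        omega
  · obtain ⟨g, hg⟩ := hfP
    by_cases hdeg : 2 ≤ f.natDegree
    · have hlp : (l : ZMod p) ≠ 0 := by
        intro h0
        rw [ZMod.natCast_eq_zero_iff, Nat.prime_dvd_prime_iff_eq Fact.out hl] at h0
        subst h0
        have h1 : (X ^ p - 1 : (ZMod p)[X]) = (X - 1) ^ p := by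
          rw [sub_pow_char, one_pow]
        have h2 : f ∣ X - 1 := hf.prime.dvd_of_dvd_pow (h1 ▸ hg ▸ dvd_mul_right f g)
        have h3 := natDegree_le_of_dvd h2 (by simpa using X_sub_C_ne_zero (1 : ZMod p))
        rw [show (X - 1 : (ZMod p)[X]) = X - C 1 by simp, natDegree_X_sub_C] at h3
        omega
      have hcop : IsCoprime f g := by
        have h1 := (X_pow_sub_one_separable_iff (F := ZMod p)).2 hlp
        rw [hg] at h1
        exact h1.isCoprime
      have hle : Module.finrank (ZMod p) (aeval T f).ker ≤ m := Submodule.finrank_le _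
      obtain ⟨b, hb⟩ := Nat.exists_eq_add_of_le hle
      have h1 := natCard_invtSubmodule_le_of_isCoprime T hf hdeg hcop (hg ▸ hP) rfl hb
      rw [hcard] at h1
      rw [← hmdef] at hfm
      generalize Module.finrank (ZMod p) (aeval T f).ker = a at *
      calc _ ≤ p ^ (a * a / 8 + a) * p ^ (b * b / 4 + b) * p ^ (2 * m) := by gcongr
        _ = p ^ (a * a / 8 + a + (b * b / 4 + b) + 2 * m) := by rw [← pow_add, ← pow_add]
        _ ≤ _ := by
          refine Nat.pow_le_pow_right (by omega) ?_
          -- What is needed is `m²/8 + 3m + 19 ≤ m²/4`, which `m ≥ 55` gives with room to spare.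
          have hb7 : b ≤ 7 := by omega
          have hbb : b * b / 4 + b ≤ 19 := by
            have : b * b ≤ 7 * 7 := Nat.mul_le_mul hb7 hb7
            omega
          have ham : a * a ≤ m * m := Nat.mul_le_mul hle hle
          have hmm : 55 * m ≤ m * m := Nat.mul_le_mul_right m hm
          omega
    · exfalso
      have hd0 := hf.natDegree_pos
      have hd1 : f.degree = 1 := by
        rw [degree_eq_natDegree hf.ne_zero]
        norm_cast
        omega
      obtain ⟨a, ha⟩ := exists_root_of_degree_eq_one hd1
      obtain ⟨h, hh⟩ := dvd_iff_isRoot.2 ha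
      -- A linear `f` is associated to `X - a`, so `T - a` would have rank at most 7.
      have hle : (aeval T f).ker ≤ (T - a • 1).ker := by
        have hu : IsUnit h := by
          rcases hf.isUnit_or_isUnit hh with h1 | h1
          · exact absurd h1 (not_isUnit_X_sub_C a)
          · exact h1
        have h2 : Function.Injective (aeval T h) :=
          ((Module.End.isUnit_iff _).1 (hu.map (aeval T))).injective
        intro x hx
        rw [LinearMap.mem_ker, hh, mul_comm, map_mul] at hx
        have h3 : aeval T (X - C a) x = 0 := by
          apply h2
          rw [map_zero]
          exact hx
        simpa [Algebra.algebraMap_eq_smul_one] using h3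
      have h1 := Submodule.finrank_mono hle
      have h2 := (T - a • 1).finrank_range_add_finrank_ker
      have h3 := hrank a
      omega

end PrimeOrder

/-! ### The Heisenberg group as a target for detecting commutators -/

/-- The Heisenberg group over `R`: the upper unitriangular `3 × 3` matrices with `a`, `b` next to
the diagonal and `c` in the corner. -/
@[ext] structure Heisenberg (R : Type*) where
  a : R
  b : R
  c : R

namespace Heisenberg

variable {R : Type*} [CommRing R]

instance : Mul (Heisenberg R) := ⟨fun x y => ⟨x.a + y.a, x.b + y.b, x.c + y.c + x.a * y.b⟩⟩
instance : One (Heisenberg R) := ⟨⟨0, 0, 0⟩⟩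
instance : Inv (Heisenberg R) := ⟨fun x => ⟨-x.a, -x.b, -x.c + x.a * x.b⟩⟩

@[simp] theorem mul_a (x y : Heisenberg R) : (x * y).a = x.a + y.a := rfl
@[simp] theorem mul_b (x y : Heisenberg R) : (x * y).b = x.b + y.b := rfl
@[simp] theorem mul_c (x y : Heisenberg R) : (x * y).c = x.c + y.c + x.a * y.b := rfl
@[simp] theorem one_a : (1 : Heisenberg R).a = 0 := rfl
@[simp] theorem one_b : (1 : Heisenberg R).b = 0 := rfl
@[simp] theorem one_c : (1 : Heisenberg R).c = 0 := rfl
@[simp] theorem inv_a (x : Heisenberg R) : x⁻¹.a = -x.a := rfl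
@[simp] theorem inv_b (x : Heisenberg R) : x⁻¹.b = -x.b := rfl
@[simp] theorem inv_c (x : Heisenberg R) : x⁻¹.c = -x.c + x.a * x.b := rfl

instance : Group (Heisenberg R) :=
  Group.ofLeftAxioms
    (fun x y z => by ext <;> simp <;> ring)
    (fun x => by ext <;> simp)
    (fun x => by ext <;> simp)

@[simp] theorem pow_a (x : Heisenberg R) (n : ℕ) : (x ^ n).a = n * x.a := by
  induction n with
  | zero => simp
  | succ n ih => rw [pow_succ, mul_a, ih]; push_cast; ring

@[simp] theorem pow_b (x : Heisenberg R) (n : ℕ) : (x ^ n).b = n * x.b := by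
  induction n with
  | zero => simp
  | succ n ih => rw [pow_succ, mul_b, ih]; push_cast; ring

theorem pow_c (x : Heisenberg R) (n : ℕ) : (x ^ n).c = n * x.c + n.choose 2 * (x.a * x.b) := by
  induction n with
  | zero => simp
  | succ n ih =>
    rw [pow_succ, mul_c, ih, pow_a, Nat.choose_succ_succ' n 1, Nat.choose_one_right]
    push_cast
    ring

@[simp] theorem commutator_a (x y : Heisenberg R) : ⁅x, y⁆.a = 0 := by
  simp [commutatorElement_def]

@[simp] theorem commutator_b (x y : Heisenberg R) : ⁅x, y⁆.b = 0 := by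
  simp [commutatorElement_def]

@[simp] theorem commutator_c (x y : Heisenberg R) : ⁅x, y⁆.c = x.a * y.b - x.b * y.a := by
  simp [commutatorElement_def]
  ring

/-- A filtration of the Heisenberg group that descends at least as fast as the lower `p`-series. -/
def filtration (R : Type*) [CommRing R] (p i : ℕ) : Subgroup (Heisenberg R) where
  carrier := {x | (p : R) ^ (i - 1) ∣ x.a ∧ (p : R) ^ (i - 1) ∣ x.b ∧ (p : R) ^ (i - 2) ∣ x.c}
  mul_mem' := by
    rintro x y ⟨h1, h2, h3⟩ ⟨h4, h5, h6⟩
    exact ⟨dvd_add h1 h4, dvd_add h2 h5, dvd_add (dvd_add h3 h6)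
      (((pow_dvd_pow _ (by omega)).trans h1).mul_right _)⟩
  one_mem' := by simp
  inv_mem' := by
    rintro x ⟨h1, h2, h3⟩
    exact ⟨(dvd_neg).2 h1, (dvd_neg).2 h2, dvd_add ((dvd_neg).2 h3)
      (((pow_dvd_pow _ (by omega)).trans h1).mul_right _)⟩

theorem mem_filtration {p i : ℕ} {x : Heisenberg R} : x ∈ filtration R p i ↔
    (p : R) ^ (i - 1) ∣ x.a ∧ (p : R) ^ (i - 1) ∣ x.b ∧ (p : R) ^ (i - 2) ∣ x.c := Iff.rfl

/-- A `p`-th power multiplies the linear coordinates by `p` and adds `p.choose 2 * a * b` to `p *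
c`; that extra term is harmless because `a` is already divisible enough. Commutators have no linear
coordinates, which is why `c` lags one power of `p` behind. -/
theorem lowerPSeries_map_mem {G : Type*} [Group G] (φ : G →* Heisenberg R) (p i : ℕ) :
    ∀ x ∈ lowerPSeries p G i, φ x ∈ filtration R p i := by
  induction i with
  | zero => intro x _; simp [mem_filtration]
  | succ i ih =>
    cases i with
    | zero => intro x _; simp [mem_filtration]
    | succ i =>
      suffices h : lowerPSeries p G (i + 2) ≤ (filtration R p (i + 2)).comap φ from h
      conv_lhs => rw [lowerPSeries]
      refine sup_le ?_ ?_
      · rw [Subgroup.closure_le]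
        rintro _ ⟨x, hx, rfl⟩
        obtain ⟨h1, h2, h3⟩ := ih x hx
        simp only [Nat.add_sub_cancel, Subgroup.coe_comap, Set.mem_preimage, SetLike.mem_coe,
          mem_filtration, map_pow, pow_a, pow_b, pow_c] at h1 h2 h3 ⊢
        refine ⟨?_, ?_, dvd_add ?_ ((h1.mul_right _).mul_left _)⟩
        · rw [show i + 2 - 1 = i + 1 by omega, pow_succ']
          exact mul_dvd_mul_left _ h1
        · rw [show i + 2 - 1 = i + 1 by omega, pow_succ']
          exact mul_dvd_mul_left _ h2
        -- By truncated subtraction the exponent for `c` is `0` at both indices 1 and 2, so the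
        -- first step requires nothing; afterwards it grows by one.
        · cases i with
          | zero => simp
          | succ i =>
            rw [pow_succ']
            exact mul_dvd_mul_left _ h3
      · rw [Subgroup.commutator_le]
        intro x hx y _
        obtain ⟨h1, h2, h3⟩ := ih x hx
        simp only [Nat.add_sub_cancel, Subgroup.mem_comap, mem_filtration, map_commutatorElement,
          commutator_a, commutator_b, commutator_c, dvd_zero, true_and] at h1 h2 h3 ⊢
        exact dvd_sub (h1.mul_right _) (h2.mul_right _)

end Heisenberg

/-! ### Exponent sums and homomorphisms to the Heisenberg group -/

/-- The exponent sums of the generators in a word, with values in `R`. -/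
def exponentVec (R : Type*) [CommRing R] {d : ℕ} :
    FreeGroup (Fin d) →* Multiplicative (Fin d → R) :=
  FreeGroup.lift fun i => Multiplicative.ofAdd (Pi.single i 1)

section Functionals

variable {R : Type*} [CommRing R] {d : ℕ}

theorem exponentVec_of (i : Fin d) :
    (exponentVec R (FreeGroup.of i)).toAdd = Pi.single i 1 := by
  simp [exponentVec]

theorem intCast_exponentVec {p : ℕ} (x : FreeGroup (Fin d)) (i : Fin d) :
    (((exponentVec ℤ x).toAdd i : ℤ) : ZMod p) = (exponentVec (ZMod p) x).toAdd i := by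
  induction x using FreeGroup.induction_on with
  | C1 => simp
  | of j =>
    rw [exponentVec_of, exponentVec_of]
    by_cases h : i = j
    · subst h; simp
    · simp [h]
  | inv_of j h => simpa using h
  | mul x y hx hy => simp [hx, hy]

theorem exponentVec_freeLift {p : ℕ} [NeZero p] (A : Matrix (Fin d) (Fin d) (ZMod p))
    (x : FreeGroup (Fin d)) :
    (exponentVec (ZMod p) (freeLift A x)).toAdd =
      A.mulVec (exponentVec (ZMod p) x).toAdd := by
  induction x using FreeGroup.induction_on with
  | C1 => simp
  | of j =>
    rw [freeLift, FreeGroup.lift_apply_of, map_list_prod, List.map_ofFn, List.prod_ofFn,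
      toAdd_prod, exponentVec_of, Matrix.mulVec_single_one]
    ext k
    rw [Finset.sum_apply, Finset.sum_eq_single k]
    · simp [exponentVec_of]
    · intro i _ hik
      simp [exponentVec_of, hik]
    · simp
  | inv_of j h => simpa [Matrix.mulVec_neg] using h
  | mul x y hx hy => simp [hx, hy, Matrix.mulVec_add]

theorem exponentVec_surjective {p : ℕ} [NeZero p] (v : Fin d → ZMod p) :
    ∃ x, (exponentVec (ZMod p) (d := d) x).toAdd = v := by
  refine ⟨(List.ofFn fun i => FreeGroup.of i ^ (v i).val).prod, ?_⟩
  rw [map_list_prod, List.map_ofFn, List.prod_ofFn, toAdd_prod]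
  ext k
  rw [Finset.sum_apply, Finset.sum_eq_single k]
  · simp [exponentVec_of]
  · intro i _ hik
    simp [exponentVec_of, hik]
  · simp

/-- The homomorphism to the Heisenberg group with prescribed linear parts. -/
def heisenbergHom (α β : Fin d → R) : FreeGroup (Fin d) →* Heisenberg R :=
  FreeGroup.lift fun i => ⟨α i, β i, 0⟩

theorem heisenbergHom_of (α β : Fin d → R) (i : Fin d) :
    heisenbergHom α β (FreeGroup.of i) = ⟨α i, β i, 0⟩ := by
  simp [heisenbergHom]

theorem heisenbergHom_a (α β : Fin d → R) (x : FreeGroup (Fin d)) :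
    (heisenbergHom α β x).a = α ⬝ᵥ (exponentVec R x).toAdd := by
  induction x using FreeGroup.induction_on with
  | C1 => simp
  | of j => simp [heisenbergHom_of, exponentVec_of]
  | inv_of j h => simpa using h
  | mul x y hx hy => simp [hx, hy, dotProduct_add]

theorem heisenbergHom_b (α β : Fin d → R) (x : FreeGroup (Fin d)) :
    (heisenbergHom α β x).b = β ⬝ᵥ (exponentVec R x).toAdd := by
  induction x using FreeGroup.induction_on with
  | C1 => simp
  | of j => simp [heisenbergHom_of, exponentVec_of]
  | inv_of j h => simpa using h
  | mul x y hx hy => simp [hx, hy, dotProduct_add]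

theorem dvd_exponentVec {p n : ℕ} {x : FreeGroup (Fin d)}
    (hx : x ∈ lowerPSeries p (FreeGroup (Fin d)) n) (i : Fin d) :
    (p : R) ^ (n - 1) ∣ (exponentVec R x).toAdd i := by
  have := (Heisenberg.lowerPSeries_map_mem (heisenbergHom (Pi.single i (1 : R)) 0) p n x hx).1
  rwa [heisenbergHom_a, single_one_dotProduct] at this

end Functionals

/-! ### The layers as vector spaces over the prime field -/

instance (p d n : ℕ) : CommGroup (layer p d n) :=
  { (inferInstance : Group (layer p d n)) with
    mul_comm := fun a b => Subtype.ext (layer_central a.2 b) }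

/-- The elementary abelian group `F_n / F_{n+1}`, written additively. -/
abbrev LayerSpace (p d n : ℕ) : Type := Additive (layer p d n)

instance (p d n : ℕ) : Module (ZMod p) (LayerSpace p d n) :=
  AddCommGroup.zmodModule fun x => by
    obtain ⟨_, y, hy, rfl⟩ := x
    exact congrArg Additive.ofMul (Subtype.ext (lowerPSeries.mk_pow hy))

instance (p d n : ℕ) [Fact p.Prime] : Finite (LayerSpace p d n) :=
  inferInstanceAs (Finite (layer p d n))

instance (p d n : ℕ) [Fact p.Prime] : Module.Finite (ZMod p) (LayerSpace p d n) :=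
  Module.Finite.of_finite

namespace LayerSpace

variable {p d n : ℕ}

/-- The projection of `F_n` onto `F_n / F_{n+1}`. -/
def mk : lowerPSeries p (FreeGroup (Fin d)) n →* layer p d n :=
  ((QuotientGroup.mk' _).domRestrict _).codRestrict _ fun x => ⟨x, x.2, rfl⟩

theorem mk_surjective : Function.Surjective (mk : _ →* layer p d n) := by
  rintro ⟨_, x, hx, rfl⟩
  exact ⟨⟨x, hx⟩, rfl⟩

theorem mk_eq_one {x : lowerPSeries p (FreeGroup (Fin d)) n} :
    mk x = 1 ↔ (x : FreeGroup (Fin d)) ∈ lowerPSeries p (FreeGroup (Fin d)) (n + 1) := by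
  rw [← QuotientGroup.eq_one_iff, Subtype.ext_iff]
  rfl

/-- The linear map induced on `F_n / F_{n+1}` by an endomorphism of `F`. -/
def map (f : FreeGroup (Fin d) →* FreeGroup (Fin d)) : Module.End (ZMod p) (LayerSpace p d n) :=
  AddMonoidHom.toZModLinearMap p (MonoidHom.toAdditive
    (((quotMap n f).domRestrict (layer p d n)).codRestrict _ fun x => quotMap_mem f x.2))

theorem map_mk (f : FreeGroup (Fin d) →* FreeGroup (Fin d))
    (x : lowerPSeries p (FreeGroup (Fin d)) n) :
    map f (Additive.ofMul (mk x)) =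
      Additive.ofMul (mk ⟨f x, lowerPSeries.map_mem f n x x.2⟩) := rfl

/-- Functionals on `F_n / F_{n+1}` from homomorphisms on `F_n` that vanish on `F_{n+1}`. -/
noncomputable def lift {M : Type*} [AddCommGroup M] [Module (ZMod p) M]
    (φ : lowerPSeries p (FreeGroup (Fin d)) n →* Multiplicative M)
    (hφ : ∀ x : lowerPSeries p (FreeGroup (Fin d)) n, (x : FreeGroup (Fin d)) ∈ lowerPSeries p (FreeGroup (Fin d)) (n + 1) → φ x = 1) :
    LayerSpace p d n →ₗ[ZMod p] M :=
  AddMonoidHom.toZModLinearMap p (MonoidHom.toAdditiveLeft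
    (mk.liftOfSurjective mk_surjective ⟨φ, fun x hx => hφ x (mk_eq_one.1 hx)⟩))

theorem lift_mk {M : Type*} [AddCommGroup M] [Module (ZMod p) M]
    (φ : lowerPSeries p (FreeGroup (Fin d)) n →* Multiplicative M)
    (hφ : ∀ x : lowerPSeries p (FreeGroup (Fin d)) n, (x : FreeGroup (Fin d)) ∈ lowerPSeries p (FreeGroup (Fin d)) (n + 1) → φ x = 1)
    (x : lowerPSeries p (FreeGroup (Fin d)) n) :
    lift φ hφ (Additive.ofMul (mk x)) = (φ x).toAdd :=
  congrArg Multiplicative.toAdd (MonoidHom.liftOfRightInverse_comp_apply mk _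
    (Function.rightInverse_surjInv mk_surjective) ⟨φ, fun x hx => hφ x (mk_eq_one.1 hx)⟩ x)

theorem val_smul_mk [NeZero p] (a : ZMod p) (x : lowerPSeries p (FreeGroup (Fin d)) n) :
    a • (Additive.ofMul (mk x) : LayerSpace p d n) = Additive.ofMul (mk (x ^ a.val)) := by
  conv_lhs => rw [← ZMod.natCast_zmod_val a, Nat.cast_smul_eq_nsmul, ← ofMul_pow, ← map_pow]

/-- Over the prime field the subgroup generated by a set is already its span, so generating sets and
spanning sets are the same. -/
theorem finrank_eq [Fact p.Prime] :
    Module.finrank (ZMod p) (LayerSpace p d n) = layerRank p d n := by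
  have hclosure : ∀ S : Finset (layer p d n), Subgroup.closure (S : Set (layer p d n)) = ⊤ ↔
      Submodule.span (ZMod p) (Additive.toMul ⁻¹' (S : Set (layer p d n))) = ⊤ := by
    intro S
    have h : (Submodule.span (ZMod p) (Additive.toMul ⁻¹' (S : Set (layer p d n)))) =
        AddSubgroup.toZModSubmodule p
          (Subgroup.toAddSubgroup (Subgroup.closure (S : Set (layer p d n)))) := by
      rw [Subgroup.toAddSubgroup_closure]
      refine le_antisymm (Submodule.span_le.2 fun x hx => AddSubgroup.subset_closure hx) ?_
      change AddSubgroup.closure _ ≤ (Submodule.span (ZMod p) _).toAddSubgroup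
      rw [AddSubgroup.closure_le]
      exact Submodule.subset_span
    rw [h, map_eq_top_iff, map_eq_top_iff]
  apply le_antisymm
  · obtain ⟨S, hS, hS'⟩ := Group.rank_spec (layer p d n)
    rw [hclosure] at hS'
    rw [layerRank, ← hS, ← finrank_top, ← hS']
    classical
    exact finrank_span_finset_le_card (R := ZMod p) (M := LayerSpace p d n) S
  · let b := Module.finBasis (ZMod p) (LayerSpace p d n)
    classical
    let S : Finset (layer p d n) := Finset.univ.image fun i => (b i).toMul
    have hS : Subgroup.closure (S : Set (layer p d n)) = ⊤ := by
      rw [hclosure, ← b.span_eq]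
      congr 1
      ext x
      simp [S]
    calc layerRank p d n ≤ S.card := Group.rank_le hS
      _ ≤ _ := Finset.card_image_le
      _ = _ := by simp

end LayerSpace

/-! ### Fixed subgroups as invariant subspaces -/

section Action

variable {p d n : ℕ}

/-- Subgroups of `F_n / F_{n+1}` are its subspaces. -/
def layerSubgroupEquiv (p d n : ℕ) :
    LayerSubgroup p d n ≃ Submodule (ZMod p) (LayerSpace p d n) :=
  { toFun := fun N => N.1.subgroupOf (layer p d n)
    invFun := fun H => ⟨H.map (layer p d n).subtype, by
      have hle : H.map (layer p d n).subtype ≤ layer p d n := Subgroup.map_subtype_le H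
      refine ⟨⟨fun a ha b => ?_⟩, hle⟩
      rwa [← layer_central (hle ha) b, mul_inv_cancel_right]⟩
    left_inv := fun N => Subtype.ext (by
      simpa using N.2.2)
    right_inv := fun H => Subgroup.comap_map_eq_self_of_injective (Subgroup.subtype_injective _) H :
    LayerSubgroup p d n ≃ Subgroup (layer p d n) }.trans
  (Subgroup.toAddSubgroup.toEquiv.trans (AddSubgroup.toZModSubmodule p).toEquiv)

theorem mem_layerSubgroupEquiv {N : LayerSubgroup p d n} {x : LayerSpace p d n} :
    x ∈ layerSubgroupEquiv p d n N ↔ ((x.toMul : layer p d n) : FreeQuot p d n) ∈ N.1 := Iff.rfl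

variable [Fact p.Prime]

theorem natCard_layerSubgroup :
    Nat.card (LayerSubgroup p d n) = galoisNumber p (layerRank p d n) := by
  rw [Nat.card_congr (layerSubgroupEquiv p d n), Submodule.natCard_eq_galoisNumber,
    LayerSpace.finrank_eq, Nat.card_zmod]

theorem natCard_fixedBy_le (g : Matrix.GeneralLinearGroup (Fin d) (ZMod p)) :
    Nat.card (MulAction.fixedBy (LayerSubgroup p d n) g) ≤
      Nat.card (LayerSpace.map (freeLift g.1) :
        Module.End (ZMod p) (LayerSpace p d n)).invtSubmodule := by
  refine Nat.card_le_card_of_injective (fun N => ⟨layerSubgroupEquiv p d n N.1, ?_⟩) ?_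
  · rw [Module.End.mem_invtSubmodule]
    intro x hx
    have h : N.1.1.map (quotMap n (freeLift g.1)) = N.1.1 := congrArg Subtype.val N.2
    rw [Submodule.mem_comap, mem_layerSubgroupEquiv, ← h]
    exact ⟨_, mem_layerSubgroupEquiv.1 hx, rfl⟩
  · intro N₁ N₂ h
    exact Subtype.ext ((layerSubgroupEquiv p d n).injective (Subtype.ext_iff.1 h :))

theorem LayerSpace.map_freeLift_mul (g h : Matrix (Fin d) (Fin d) (ZMod p)) :
    (LayerSpace.map (freeLift (g * h)) : Module.End (ZMod p) (LayerSpace p d n)) =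
      LayerSpace.map (freeLift g) * LayerSpace.map (freeLift h) := by
  refine LinearMap.ext fun x => congrArg Additive.ofMul (Subtype.ext ?_)
  obtain ⟨_, y, hy, rfl⟩ := x
  exact quotMap_eq (freeLift_mul g h) ⟨y, hy, rfl⟩

theorem LayerSpace.map_freeLift_one :
    (LayerSpace.map (freeLift (1 : Matrix (Fin d) (Fin d) (ZMod p))) :
      Module.End (ZMod p) (LayerSpace p d n)) = 1 := by
  refine LinearMap.ext fun x => congrArg Additive.ofMul (Subtype.ext ?_)
  obtain ⟨_, y, hy, rfl⟩ := x
  exact (quotMap_eq (g := MonoidHom.id _) freeLift_one ⟨y, hy, rfl⟩).trans rfl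

theorem LayerSpace.map_freeLift_pow (g : Matrix.GeneralLinearGroup (Fin d) (ZMod p)) (k : ℕ) :
    (LayerSpace.map (freeLift (g ^ k).1) : Module.End (ZMod p) (LayerSpace p d n)) =
      LayerSpace.map (freeLift g.1) ^ k := by
  induction k with
  | zero => exact LayerSpace.map_freeLift_one
  | succ k ih => rw [pow_succ, pow_succ, Units.val_mul, LayerSpace.map_freeLift_mul, ih]

end Action

-- Non-trivial matrices do not act as scalars

universe u

theorem lowerPSeries.pow_pow_mem {p : ℕ} {G : Type*} [Group G] {i : ℕ} {x : G}
    (hx : x ∈ lowerPSeries p G i) (k : ℕ) : x ^ p ^ k ∈ lowerPSeries p G (i + k) := by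
  induction k with
  | zero => simpa using hx
  | succ k ih => rw [pow_succ, pow_mul]; exact lowerPSeries.pow_mem ih

theorem lowerPSeries.commutator_mem_two {p : ℕ} {G : Type*} [Group G] (x y : G) :
    ⁅x, y⁆ ∈ lowerPSeries p G 2 :=
  lowerPSeries.commutator_mem (i := 1) (Subgroup.mem_top x) y

theorem lowerPSeries.pow_mem_two {p : ℕ} {G : Type*} [Group G] (x : G) :
    x ^ p ∈ lowerPSeries p G 2 :=
  lowerPSeries.pow_mem (i := 1) (Subgroup.mem_top x)

/-- Test on the `p ^ (n - 1)`-th powers of the generators. Their integral exponent sums are `p ^ (n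
- 1)` times those of the generators, while `F_{n+1}` has exponent sums divisible by `p ^ n`;
dividing leaves the columns of `A` modulo `p`. -/
theorem eq_smul_one_of_pow_eq_scalar {p d n : ℕ} [Fact p.Prime] (hn : 1 ≤ n)
    {A : Matrix (Fin d) (Fin d) (ZMod p)} {a : ZMod p}
    (h : ∀ x ∈ lowerPSeries p (FreeGroup (Fin d)) n,
      freeLift A x * (x ^ a.val)⁻¹ ∈ lowerPSeries p (FreeGroup (Fin d)) (n + 1)) :
    A = a • 1 := by
  obtain ⟨n, rfl⟩ := Nat.exists_eq_add_of_le' hn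
  have hp : (p : ℤ) ^ n ≠ 0 := pow_ne_zero _ (by exact_mod_cast (Fact.out : p.Prime).ne_zero)
  ext i j
  have h1 := h _ (add_comm n 1 ▸ lowerPSeries.pow_pow_mem (i := 1)
    (Subgroup.mem_top (FreeGroup.of j)) n)
  have h2 := dvd_exponentVec (R := ℤ) h1 i
  have h3 : (exponentVec ℤ (freeLift A (FreeGroup.of j ^ p ^ n) *
      ((FreeGroup.of j ^ p ^ n) ^ a.val)⁻¹)).toAdd i =
      (p : ℤ) ^ n * ((exponentVec ℤ (freeLift A (FreeGroup.of j))).toAdd i -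
        a.val * (exponentVec ℤ (FreeGroup.of j)).toAdd i) := by
    simp [-ZMod.natCast_val]
    ring
  rw [h3, Nat.add_sub_cancel, pow_succ, mul_dvd_mul_iff_left hp,
    ← ZMod.intCast_zmod_eq_zero_iff_dvd] at h2
  push_cast at h2
  rw [intCast_exponentVec, intCast_exponentVec, exponentVec_freeLift, exponentVec_of,
    Matrix.mulVec_single_one, ZMod.natCast_zmod_val, sub_eq_zero] at h2
  rw [Matrix.smul_apply, Matrix.one_apply, smul_eq_mul]
  simpa [Pi.single_apply, Matrix.col_apply] using h2

/-- Test on the `p ^ (n - 2)`-th power of `[y_i, y_j]`: the matrix `a • 1` multiplies the commutator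
by `a²`, the scalar multiplies it by `a`, and the corner coordinate over `ℤ` compares the two modulo
`p`. -/
theorem mul_self_eq_of_commutator_eq_scalar {p d n : ℕ} [Fact p.Prime] (hn : 2 ≤ n) {i j : Fin d}
    (hij : i ≠ j) {a : ZMod p}
    (h : ∀ x ∈ lowerPSeries p (FreeGroup (Fin d)) n,
      freeLift (a • (1 : Matrix (Fin d) (Fin d) (ZMod p))) x * (x ^ a.val)⁻¹ ∈ lowerPSeries p (FreeGroup (Fin d)) (n + 1)) :
    a * a = a := by
  obtain ⟨n, rfl⟩ := Nat.exists_eq_add_of_le' hn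
  have hp : (p : ℤ) ^ n ≠ 0 := pow_ne_zero _ (by exact_mod_cast (Fact.out : p.Prime).ne_zero)
  have h1 := h _ (add_comm n 2 ▸ lowerPSeries.pow_pow_mem
    (lowerPSeries.commutator_mem_two (FreeGroup.of i) (FreeGroup.of j)) n)
  have h2 := (Heisenberg.lowerPSeries_map_mem
    (heisenbergHom (Pi.single i (1 : ℤ)) (Pi.single j 1)) _ _ _ h1).2.2
  have h3 : (heisenbergHom (Pi.single i (1 : ℤ)) (Pi.single j 1)
      (freeLift (a • (1 : Matrix (Fin d) (Fin d) (ZMod p))) (⁅FreeGroup.of i, FreeGroup.of j⁆ ^ p ^ n) *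
        ((⁅FreeGroup.of i, FreeGroup.of j⁆ ^ p ^ n) ^ a.val)⁻¹)).c =
      (p : ℤ) ^ n *
        ((exponentVec ℤ (freeLift (a • (1 : Matrix (Fin d) (Fin d) (ZMod p))) (FreeGroup.of i))).toAdd i *
          (exponentVec ℤ (freeLift (a • (1 : Matrix (Fin d) (Fin d) (ZMod p))) (FreeGroup.of j))).toAdd j -
        (exponentVec ℤ (freeLift (a • (1 : Matrix (Fin d) (Fin d) (ZMod p))) (FreeGroup.of i))).toAdd j *
          (exponentVec ℤ (freeLift (a • (1 : Matrix (Fin d) (Fin d) (ZMod p))) (FreeGroup.of j))).toAdd i - a.val) := by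
    simp [-ZMod.natCast_val, Heisenberg.pow_c, heisenbergHom_a, heisenbergHom_b, exponentVec_of, hij, hij.symm,
      map_commutatorElement]
    ring
  rw [h3, show n + 2 + 1 - 2 = n + 1 by omega, pow_succ, mul_dvd_mul_iff_left hp,
    ← ZMod.intCast_zmod_eq_zero_iff_dvd] at h2
  push_cast at h2
  simp only [intCast_exponentVec, exponentVec_freeLift, exponentVec_of, Matrix.mulVec_single_one,
    ZMod.natCast_zmod_val, sub_eq_zero] at h2
  simpa [hij, hij.symm, Matrix.one_apply] using h2

theorem LayerSpace.exists_map_ne_smul {p d n : ℕ} [Fact p.Prime] (hn : 2 ≤ n) (hd : 2 ≤ d)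
    {g : Matrix.GeneralLinearGroup (Fin d) (ZMod p)} (hg : g ≠ 1) (a : ZMod p) :
    ∃ x : LayerSpace p d n, LayerSpace.map (freeLift g.1) x ≠ a • x := by
  by_contra! hcon
  have h : ∀ x ∈ lowerPSeries p (FreeGroup (Fin d)) n,
      freeLift g.1 x * (x ^ a.val)⁻¹ ∈ lowerPSeries p (FreeGroup (Fin d)) (n + 1) := by
    intro x hx
    have h1 := hcon (Additive.ofMul (LayerSpace.mk ⟨x, hx⟩))
    rw [LayerSpace.map_mk, LayerSpace.val_smul_mk] at h1
    have h2 := Additive.ofMul.injective h1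
    rw [← mul_inv_eq_one, ← map_inv, ← map_mul, LayerSpace.mk_eq_one] at h2
    exact h2
  have hA := eq_smul_one_of_pow_eq_scalar (by omega) h
  rw [hA] at h
  have ha := mul_self_eq_of_commutator_eq_scalar hn
    (i := (⟨0, by omega⟩ : Fin d)) (j := ⟨1, by omega⟩) (by simp) h
  rcases eq_or_ne a 0 with rfl | ha0
  · have : Nonempty (Fin d) := ⟨⟨0, by omega⟩⟩
    exact g.ne_zero (by rw [hA, zero_smul])
  · have ha1 : a = 1 := mul_left_cancel₀ ha0 (by rw [ha, mul_one])
    exact hg (Units.ext (by rw [hA, ha1, one_smul]; rfl))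

/-! ### Rank estimates on the second layer -/

theorem LinearIndependent.exists_basis_sum {K ι : Type*} {V : Type u} [Field K] [AddCommGroup V]
    [Module K V] {v : ι → V} (hv : LinearIndependent K v) :
    ∃ (κ : Type u) (b : Module.Basis (ι ⊕ κ) K V), ∀ i, b (Sum.inl i) = v i :=
  ⟨_, Module.Basis.sumExtend hv, fun i => by
    rw [Module.Basis.sumExtend, Module.Basis.reindex_apply, Module.Basis.extend_apply_self]
    rfl⟩

theorem LinearMap.card_le_finrank_range_of_dual {K V ι : Type*} [Field K] [AddCommGroup V]
    [Module K V] [Module.Finite K V] [Fintype ι] (N : Module.End K V) (y : ι → V)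
    (φ : ι → Module.Dual K V) {c : K} (hc : c ≠ 0) (hdiag : ∀ i, φ i (N (y i)) = c)
    (hoff : ∀ i j, i ≠ j → φ i (N (y j)) = 0) : Fintype.card ι ≤ Module.finrank K N.range := by
  have h : LinearIndependent K fun i => (⟨N (y i), ⟨y i, rfl⟩⟩ : N.range) :=
    LinearIndependent.of_pairwise_dual_eq_zero_one _
      (fun i => c⁻¹ • (φ i ∘ₗ N.range.subtype))
      (fun i j hij => by simp [hoff i j hij]) (fun i => by simp [hdiag, hc])
  exact h.fintype_card_le_finrank

namespace LayerSpace

variable {p d : ℕ}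

/-- The class of `[x, y]` in `F_2 / F_3`. -/
def commutator (x y : FreeGroup (Fin d)) : LayerSpace p d 2 :=
  Additive.ofMul (mk ⟨⁅x, y⁆, lowerPSeries.commutator_mem_two x y⟩)

/-- The class of `x ^ p` in `F_2 / F_3`. -/
def pow (x : FreeGroup (Fin d)) : LayerSpace p d 2 :=
  Additive.ofMul (mk ⟨x ^ p, lowerPSeries.pow_mem_two x⟩)

theorem map_commutator (f : FreeGroup (Fin d) →* FreeGroup (Fin d)) (x y : FreeGroup (Fin d)) :
    map f (commutator x y : LayerSpace p d 2) = commutator (f x) (f y) := by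
  rw [commutator, map_mk]
  congr 3
  exact map_commutatorElement f x y

theorem map_pow (f : FreeGroup (Fin d) →* FreeGroup (Fin d)) (x : FreeGroup (Fin d)) :
    map f (pow x : LayerSpace p d 2) = pow (f x) := by
  rw [pow, map_mk]
  congr 3
  exact _root_.map_pow f x p

variable [Fact p.Prime]

/-- The functional `[x, y] ↦ α(x) β(y) - β(x) α(y)` on `F_2 / F_3`. -/
noncomputable def commutatorFunctional (α β : Fin d → ZMod p) :
    Module.Dual (ZMod p) (LayerSpace p d 2) :=
  lift (M := ZMod p) (n := 2)
    { toFun := fun x => Multiplicative.ofAdd (heisenbergHom α β x).c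
      map_one' := by simp
      map_mul' := fun x y => by
        -- The corner coordinate is additive on `F_2` because the cross term `x.a * y.b` vanishes:
        -- modulo `p`, linear coordinates are zero there.
        have h := (Heisenberg.lowerPSeries_map_mem (heisenbergHom α β) p 2 x x.2).1
        rw [Nat.add_one_sub_one, pow_one, CharP.cast_eq_zero, zero_dvd_iff] at h
        rw [← ofAdd_add]
        simp [h] }
    fun x hx => by
      have h := (Heisenberg.lowerPSeries_map_mem (heisenbergHom α β) p 3 x hx).2.2
      rw [show 3 - 2 = 1 from rfl, pow_one, CharP.cast_eq_zero, zero_dvd_iff] at h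
      exact congrArg Multiplicative.ofAdd h

theorem commutatorFunctional_mk (α β : Fin d → ZMod p) (x : lowerPSeries p (FreeGroup (Fin d)) 2) :
    commutatorFunctional α β (Additive.ofMul (mk x)) = (heisenbergHom α β x).c :=
  lift_mk _ _ _

/-- The functional `x ^ p ↦ x_i`, `[x, y] ↦ 0` on `F_2 / F_3`. -/
noncomputable def powFunctional (i : Fin d) : Module.Dual (ZMod p) (LayerSpace p d 2) :=
  lift (M := ZMod p) (n := 2)
    { toFun := fun x =>
        Multiplicative.ofAdd (((exponentVec ℤ (x : FreeGroup (Fin d))).toAdd i / p : ℤ) : ZMod p)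
      map_one' := by simp
      map_mul' := fun x y => by
        have h := dvd_exponentVec (R := ℤ) x.2 i
        rw [Nat.add_one_sub_one, pow_one] at h
        rw [← ofAdd_add, Subgroup.coe_mul, map_mul, toAdd_mul, Pi.add_apply,
          Int.add_ediv_of_dvd_left h, Int.cast_add] }
    fun x hx => by
      obtain ⟨k, hk⟩ := dvd_exponentVec (R := ℤ) hx i
      have hp : (p : ℤ) ≠ 0 := by exact_mod_cast (Fact.out : p.Prime).ne_zero
      change Multiplicative.ofAdd (((exponentVec ℤ (x : FreeGroup (Fin d))).toAdd i / p : ℤ) :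
        ZMod p) = 1
      rw [hk, show 2 + 1 - 1 = 2 from rfl, sq, mul_assoc, Int.mul_ediv_cancel_left _ hp]
      simp

theorem powFunctional_mk (i : Fin d) (x : lowerPSeries p (FreeGroup (Fin d)) 2) :
    powFunctional i (Additive.ofMul (mk x)) =
      (((exponentVec ℤ (x : FreeGroup (Fin d))).toAdd i / p : ℤ) : ZMod p) :=
  lift_mk _ _ _

theorem commutatorFunctional_commutator (α β : Fin d → ZMod p) (x y : FreeGroup (Fin d)) :
    commutatorFunctional α β (commutator x y) =
      (α ⬝ᵥ (exponentVec (ZMod p) x).toAdd) * (β ⬝ᵥ (exponentVec (ZMod p) y).toAdd) -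
      (β ⬝ᵥ (exponentVec (ZMod p) x).toAdd) * (α ⬝ᵥ (exponentVec (ZMod p) y).toAdd) := by
  rw [commutator, commutatorFunctional_mk, map_commutatorElement, Heisenberg.commutator_c]
  simp only [heisenbergHom_a, heisenbergHom_b]

theorem commutatorFunctional_pow (α β : Fin d → ZMod p) (x : FreeGroup (Fin d)) :
    commutatorFunctional α β (pow x) = p.choose 2 *
      ((α ⬝ᵥ (exponentVec (ZMod p) x).toAdd) * (β ⬝ᵥ (exponentVec (ZMod p) x).toAdd)) := by
  rw [pow, commutatorFunctional_mk, _root_.map_pow, Heisenberg.pow_c, CharP.cast_eq_zero, zero_mul,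
    zero_add, heisenbergHom_a, heisenbergHom_b]

theorem powFunctional_pow (i : Fin d) (x : FreeGroup (Fin d)) :
    powFunctional i (pow x : LayerSpace p d 2) = (exponentVec (ZMod p) x).toAdd i := by
  have hp : (p : ℤ) ≠ 0 := by exact_mod_cast (Fact.out : p.Prime).ne_zero
  rw [pow, powFunctional_mk, _root_.map_pow, toAdd_pow, Pi.smul_apply, nsmul_eq_mul,
    Int.mul_ediv_cancel_left _ hp, intCast_exponentVec]

theorem powFunctional_commutator (i : Fin d) (x y : FreeGroup (Fin d)) :
    powFunctional i (commutator x y : LayerSpace p d 2) = 0 := by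
  rw [commutator, powFunctional_mk, map_commutatorElement,
    commutatorElement_eq_one_iff_mul_comm.2 (mul_comm _ _)]
  simp

/-- The `p`-th powers of the generators and the commutators of pairs of distinct generators have a
dual family of functionals, hence are independent. For `d ≥ 10` this makes the dimension at least
55. -/
theorem sq_add_le_two_mul_finrank :
    d * d + d ≤ 2 * Module.finrank (ZMod p) (LayerSpace p d 2) := by
  have hlt : ∀ j : Fin d, ∀ i : Fin j.1, Fin.castLE j.2.le i ≠ j := by
    intro j i h
    have := congrArg Fin.val h
    simp only [Fin.val_castLE] at this
    omega
  have hli : LinearIndependent (ZMod p) (Sum.elim (fun i : Fin d => pow (FreeGroup.of i))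
      (fun s : Σ j : Fin d, Fin j.1 =>
        commutator (FreeGroup.of (Fin.castLE s.1.2.le s.2)) (FreeGroup.of s.1)) :
      _ → LayerSpace p d 2) := by
    refine LinearIndependent.of_pairwise_dual_eq_zero_one _ (Sum.elim powFunctional
      fun s => commutatorFunctional (Pi.single (Fin.castLE s.1.2.le s.2) 1) (Pi.single s.1 1)) ?_ ?_
    · rintro (i | ⟨j, i⟩) (k | ⟨l, k⟩) h
      · have h' : i ≠ k := fun h' => h (by rw [h'])
        simp [powFunctional_pow, exponentVec_of, h']
      · simp [powFunctional_commutator]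
      -- For `p = 2` the factor `p.choose 2` is not zero; the value vanishes because the two
      -- coordinates of one generator cannot both be non-zero.
      · have := hlt j i
        by_cases h1 : j = k
        · subst h1
          simp [commutatorFunctional_pow, exponentVec_of, this]
        · simp [commutatorFunctional_pow, exponentVec_of, h1]
      · simp only [Sum.elim_inr, commutatorFunctional_commutator, exponentVec_of,
          single_one_dotProduct]
        have hj := hlt j i
        have hl := hlt l k
        have hne : ¬ (j = l ∧ Fin.castLE j.2.le i = Fin.castLE l.2.le k) := by
          rintro ⟨rfl, h2⟩
          exact h (by rw [Fin.castLE_injective _ h2])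
        have hne2 : ¬ (j = Fin.castLE l.2.le k ∧ Fin.castLE j.2.le i = l) := by
          rintro ⟨h2, h3⟩
          have h4 := congrArg Fin.val h2
          have h5 := congrArg Fin.val h3
          simp only [Fin.val_castLE] at h4 h5
          have := i.2
          have := k.2
          omega
        simp only [Pi.single_apply]
        grind
    · rintro (i | ⟨j, i⟩)
      · simp [powFunctional_pow, exponentVec_of]
      · simp [commutatorFunctional_commutator, exponentVec_of, hlt j i, (hlt j i).symm]
  have h := hli.fintype_card_le_finrank
  rw [Fintype.card_sum, Fintype.card_sigma, Fintype.card_fin] at h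
  simp only [Fintype.card_fin] at h
  rw [Fin.sum_univ_eq_sum_range (fun i => i)] at h
  have h2 := Finset.sum_range_id_mul_two d
  cases d with
  | zero => simp
  | succ d =>
    rw [Nat.add_sub_cancel] at h2
    nlinarith

/-- On `F_2 / F_3`, a non-trivial matrix is far from being a scalar. -/
theorem le_finrank_range_map_sub (hd : 10 ≤ d)
    {g : Matrix.GeneralLinearGroup (Fin d) (ZMod p)} (hg : g ≠ 1) (a : ZMod p) :
    8 ≤ Module.finrank (ZMod p)
      (map (freeLift g.1) - a • 1 : Module.End (ZMod p) (LayerSpace p d 2)).range := by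
  by_cases hscal : ∃ μ : ZMod p, g.1 = μ • 1
  · obtain ⟨μ, hμ⟩ := hscal
    by_cases haμ : μ = a
    · subst haμ
      have hne : Nonempty (Fin d) := ⟨⟨0, by omega⟩⟩
      have hμ0 : μ ≠ 0 := by
        rintro rfl
        exact g.ne_zero (by rw [hμ, zero_smul])
      have hμ1 : μ ≠ 1 := by
        rintro rfl
        exact hg (Units.ext (by rw [hμ, one_smul]; rfl))
      -- A scalar matrix `μ` acts on commutators by `μ²`, so `T - μ` multiplies the `d - 1`
      -- independent classes `[y_z, y_j]` by `μ² - μ ≠ 0`. When `μ ≠ a`, the `p`-th powers serve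
      -- instead, since `T - a` multiplies them by `μ - a`.
      let z : Fin d := ⟨0, by omega⟩
      have h := LinearMap.card_le_finrank_range_of_dual (ι := {j : Fin d // j ≠ z})
        (map (freeLift g.1) - μ • 1 : Module.End (ZMod p) (LayerSpace p d 2))
        (fun j => commutator (FreeGroup.of z) (FreeGroup.of j.1))
        (fun i => commutatorFunctional (Pi.single z 1) (Pi.single i.1 1))
        (c := μ * μ - μ) (by
          rw [show μ * μ - μ = μ * (μ - 1) by ring]
          exact mul_ne_zero hμ0 (sub_ne_zero.2 hμ1))
        (by
          rintro ⟨i, hi⟩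
          simp [map_commutator, commutatorFunctional_commutator, exponentVec_freeLift, hμ,
            exponentVec_of, hi, hi.symm])
        (by
          rintro ⟨i, hi⟩ ⟨j, hj⟩ hij
          have hij' : i ≠ j := fun h => hij (Subtype.ext h)
          simp [map_commutator, commutatorFunctional_commutator, exponentVec_freeLift, hμ,
            exponentVec_of, hi, hj, hi.symm, hj.symm, hij', hij'.symm])
      rw [Fintype.card_subtype_compl, Fintype.card_fin, Fintype.card_unique] at h
      omega
    · have h := LinearMap.card_le_finrank_range_of_dual
        (map (freeLift g.1) - a • 1 : Module.End (ZMod p) (LayerSpace p d 2))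
        (fun j : Fin d => pow (FreeGroup.of j)) (fun i => powFunctional i)
        (c := μ - a) (sub_ne_zero.2 haμ)
        (by
          intro i
          simp [map_pow, powFunctional_pow, exponentVec_freeLift, hμ, exponentVec_of])
        (by
          intro i j hij
          simp [map_pow, powFunctional_pow, exponentVec_freeLift, hμ, exponentVec_of, hij])
      rw [Fintype.card_fin] at h
      omega
  · have hex : ∃ u : Fin d → ZMod p, LinearIndependent (ZMod p) ![u, g.1.mulVec u] := by
      by_contra hcon
      push Not at hcon
      obtain ⟨μ, hμ⟩ := LinearMap.exists_eq_smul_id_of_forall_notLinearIndependent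
        (f := g.1.mulVecLin) (fun u => hcon u)
      refine hscal ⟨μ, ?_⟩
      ext i j
      have h := congrFun (LinearMap.congr_fun hμ (Pi.single j 1)) i
      simpa [Matrix.one_apply, Pi.single_apply] using h
    obtain ⟨u, hu⟩ := hex
    obtain ⟨ι, b, hb⟩ := hu.exists_basis_sum
    have hb0 : b (Sum.inl 0) = u := hb 0
    have hb1 : b (Sum.inl 1) = g.1.mulVec u := hb 1
    let f : _ → (Fin d → ZMod p) := fun i => (dotProductEquiv (ZMod p) (Fin d)).symm (b.coord i)
    have hf : ∀ i v, f i ⬝ᵥ v = b.coord i v := fun i v =>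
      LinearMap.congr_fun ((dotProductEquiv (ZMod p) (Fin d)).apply_symm_apply (b.coord i)) v
    obtain ⟨x, hx⟩ := exponentVec_surjective u
    -- With `y_i` above `g⁻¹ b_i`, the image of `[x, y_i]` under `T - a` is `[gu, b_i] - a [u, g⁻¹
    -- b_i]`. The functional built from the coordinates of `gu` and `b_i` kills the second term,
    -- both coordinates being zero at `u`. This gives rank at least `d - 2`, which is where `d ≥ 10`
    -- is needed.
    choose y hy using fun i => exponentVec_surjective ((g⁻¹).1.mulVec (b (Sum.inr i)))
    have hgy : ∀ i, g.1.mulVec (exponentVec (ZMod p) (y i)).toAdd = b (Sum.inr i) := by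
      intro i
      rw [hy, Matrix.mulVec_mulVec, ← Units.val_mul, mul_inv_cancel, Units.val_one,
        Matrix.one_mulVec]
    have := Module.Finite.finite_basis b
    have : Finite ι := Finite.sum_right (Fin 2)
    have := Fintype.ofFinite ι
    have hcard := Module.finrank_eq_card_basis b
    rw [Module.finrank_fin_fun, Fintype.card_sum, Fintype.card_fin] at hcard
    have hval : ∀ i j, commutatorFunctional (f (Sum.inl 1)) (f (Sum.inr i))
        ((map (freeLift g.1) - a • 1 : Module.End (ZMod p) (LayerSpace p d 2))
          (commutator x (y j))) = b.coord (Sum.inr i) (b (Sum.inr j)) := by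
      intro i j
      rw [LinearMap.sub_apply, map_sub, map_commutator, commutatorFunctional_commutator,
        LinearMap.smul_apply, Module.End.one_apply, map_smul, commutatorFunctional_commutator,
        exponentVec_freeLift, exponentVec_freeLift, hgy, hx]
      simp only [hf]
      have h1 : b.coord (Sum.inl 1) (g.1.mulVec u) = 1 := by rw [← hb1]; simp
      have h2 : b.coord (Sum.inr i) (g.1.mulVec u) = 0 := by rw [← hb1]; simp
      have h3 : b.coord (Sum.inl 1) u = 0 := by rw [← hb0]; simp
      have h4 : b.coord (Sum.inr i) u = 0 := by rw [← hb0]; simp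
      rw [h1, h2, h3, h4]
      simp
    have h := LinearMap.card_le_finrank_range_of_dual
      (map (freeLift g.1) - a • 1 : Module.End (ZMod p) (LayerSpace p d 2))
      (fun j => commutator x (y j))
      (fun i => commutatorFunctional (f (Sum.inl 1)) (f (Sum.inr i))) (c := 1) one_ne_zero
      (by intro i; rw [hval]; simp)
      (by intro i j hij; rw [hval]; simp [hij])
    omega

end LayerSpace

/-! ### Orbit counting for finite group actions -/

section Orbits

variable {G X : Type*} [Group G] [MulAction G X] [Finite X]

theorem natCard_orbits_mul_natCard [Fintype G] [DecidableEq G] :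
    Nat.card (MulAction.orbitRel.Quotient G X) * Nat.card G =
      Nat.card X + ∑ g ∈ Finset.univ.erase (1 : G), Nat.card (MulAction.fixedBy X g) := by
  classical
  have := Fintype.ofFinite X
  have h := MulAction.sum_card_fixedBy_eq_card_orbits_mul_card_group G X
  have h1 : Nat.card (MulAction.fixedBy X (1 : G)) = Nat.card X :=
    Nat.card_congr (Equiv.subtypeUnivEquiv fun x => by simp)
  rw [← h1, Finset.add_sum_erase _ (fun g : G => Nat.card (MulAction.fixedBy X g))
    (Finset.mem_univ (1 : G)), MulAction.orbitRel.Quotient, Nat.card_eq_fintype_card,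
    Nat.card_eq_fintype_card, ← h]
  simp only [Nat.card_eq_fintype_card]

theorem natCard_le_natCard_stabilizer_eq_bot_add [Fintype G] [DecidableEq G] :
    Nat.card X ≤ Nat.card {x : X // MulAction.stabilizer G x = ⊥} +
      ∑ g ∈ Finset.univ.erase (1 : G), Nat.card (MulAction.fixedBy X g) := by
  classical
  have := Fintype.ofFinite X
  rw [natCard_subtype_not_le fun x : X => MulAction.stabilizer G x = ⊥]
  gcongr
  have h1 : Nat.card {x : X // ¬ MulAction.stabilizer G x = ⊥} =
      (Finset.univ.filter fun x : X => ¬ MulAction.stabilizer G x = ⊥).card :=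
    Nat.subtype_card _ (by simp)
  have h2 : ∀ g : G, Nat.card (MulAction.fixedBy X g) =
      (Finset.univ.filter fun x : X => g • x = x).card := fun g =>
    Nat.subtype_card _ (by simp)
  simp only [h1, h2]
  refine (Finset.card_le_card ?_).trans Finset.card_biUnion_le
  intro x hx
  simp only [Finset.mem_filter, Finset.mem_univ, true_and, Subgroup.eq_bot_iff_forall] at hx
  push Not at hx
  obtain ⟨g, hg, hg1⟩ := hx
  rw [Finset.mem_biUnion]
  exact ⟨g, by simp [hg1], by simpa using hg⟩

/-- Stabilizers along an orbit are conjugate, so a point with trivial stabilizer lies in a regular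
orbit. It is determined by that orbit and a group element carrying the chosen representative to it.
-/
theorem natCard_stabilizer_eq_bot_le [Finite G] :
    Nat.card {x : X // MulAction.stabilizer G x = ⊥} ≤
      Nat.card {ω : MulAction.orbitRel.Quotient G X //
        ∀ x ∈ ω.orbit, MulAction.stabilizer G x = ⊥} * Nat.card G := by
  rw [← Nat.card_prod]
  have hreg : ∀ x : X, MulAction.stabilizer G x = ⊥ →
      ∀ y ∈ MulAction.orbitRel.Quotient.orbit (Quotient.mk'' x : MulAction.orbitRel.Quotient G X),
        MulAction.stabilizer G y = ⊥ := by
    rintro x hx y hy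
    rw [MulAction.orbitRel.Quotient.orbit_mk] at hy
    obtain ⟨g, rfl⟩ := hy
    change MulAction.stabilizer G (g • x) = ⊥
    rw [MulAction.stabilizer_smul_eq_stabilizer_map_conj, hx, Subgroup.map_bot]
  have hout : ∀ x : X, ∃ g : G,
      g • (Quotient.out (Quotient.mk'' x : MulAction.orbitRel.Quotient G X)) = x := by
    intro x
    have h : (Quotient.mk'' x : MulAction.orbitRel.Quotient G X) = Quotient.mk''
      (Quotient.out (Quotient.mk'' x : MulAction.orbitRel.Quotient G X)) :=
      (Quotient.out_eq' _).symm
    exact Quotient.exact h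
  choose f hf using hout
  refine Nat.card_le_card_of_injective (fun x => (⟨_, hreg x.1 x.2⟩, f x.1)) ?_
  intro x y h
  have h1 := Subtype.ext_iff.1 (congrArg Prod.fst h)
  have h2 : f x.1 = f y.1 := congrArg Prod.snd h
  refine Subtype.ext ?_
  rw [← hf x.1, ← hf y.1, h2]
  exact congrArg (fun ω : MulAction.orbitRel.Quotient G X => f y.1 • ω.out) h1

theorem orbit_estimates [Fintype G] [DecidableEq G] [Nonempty X] {ε : ℝ}
    (h : ((∑ g ∈ Finset.univ.erase (1 : G), Nat.card (MulAction.fixedBy X g) : ℕ) : ℝ) ≤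
      ε * Nat.card X) :
    (1 ≤ (Nat.card (MulAction.orbitRel.Quotient G X) : ℝ) * Nat.card G / Nat.card X ∧
      (Nat.card (MulAction.orbitRel.Quotient G X) : ℝ) * Nat.card G / Nat.card X ≤ 1 + ε) ∧
    (Nat.card {ω : MulAction.orbitRel.Quotient G X //
        ∀ x ∈ ω.orbit, MulAction.stabilizer G x = ⊥} ≤
        Nat.card (MulAction.orbitRel.Quotient G X) ∧
      (ε < 1 →
        0 < Nat.card {ω : MulAction.orbitRel.Quotient G X //
          ∀ x ∈ ω.orbit, MulAction.stabilizer G x = ⊥} ∧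
        1 ≤ (Nat.card (MulAction.orbitRel.Quotient G X) : ℝ) /
          (Nat.card {ω : MulAction.orbitRel.Quotient G X //
            ∀ x ∈ ω.orbit, MulAction.stabilizer G x = ⊥} : ℝ) ∧
        (Nat.card (MulAction.orbitRel.Quotient G X) : ℝ) /
          (Nat.card {ω : MulAction.orbitRel.Quotient G X //
            ∀ x ∈ ω.orbit, MulAction.stabilizer G x = ⊥} : ℝ) ≤ (1 + ε) / (1 - ε))) := by
  have h1 := natCard_orbits_mul_natCard (G := G) (X := X)
  have h2 := (natCard_le_natCard_stabilizer_eq_bot_add (G := G) (X := X)).trans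
    (Nat.add_le_add_right natCard_stabilizer_eq_bot_le _)
  have h3 : Nat.card {ω : MulAction.orbitRel.Quotient G X //
      ∀ x ∈ ω.orbit, MulAction.stabilizer G x = ⊥} ≤
      Nat.card (MulAction.orbitRel.Quotient G X) := Finite.card_subtype_le _
  have hX : 0 < Nat.card X := Nat.card_pos
  have hG : 0 < Nat.card G := Nat.card_pos
  generalize Nat.card {ω : MulAction.orbitRel.Quotient G X //
    ∀ x ∈ ω.orbit, MulAction.stabilizer G x = ⊥} = D at *
  generalize Nat.card (MulAction.orbitRel.Quotient G X) = O at *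
  generalize (∑ g ∈ Finset.univ.erase (1 : G), Nat.card (MulAction.fixedBy X g)) = E at *
  generalize Nat.card G = c at *
  generalize Nat.card X = x at *
  have h1' : (O : ℝ) * c = x + E := by exact_mod_cast h1
  have h2' : (x : ℝ) ≤ D * c + E := by exact_mod_cast h2
  have h3' : (D : ℝ) ≤ O := by exact_mod_cast h3
  have hX' : (0 : ℝ) < x := by exact_mod_cast hX
  have hG' : (0 : ℝ) < c := by exact_mod_cast hG
  have hE : (0 : ℝ) ≤ E := Nat.cast_nonneg _
  refine ⟨⟨?_, ?_⟩, h3, fun hε => ?_⟩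
  · rw [h1', one_le_div hX']
    linarith
  · rw [h1', div_le_iff₀ hX']
    linarith
  -- The regular orbits cover at least `(1 - ε) |X|` points, while the number of all orbits times
  -- `|G|` is at most `(1 + ε) |X|`.
  · have h4 : (1 - ε) * x ≤ D * c := by linarith
    have hD : (0 : ℝ) < D := by
      by_contra hD
      have : (D : ℝ) * c ≤ 0 := mul_nonpos_of_nonpos_of_nonneg (not_lt.1 hD) hG'.le
      have : 0 < (1 - ε) * x := mul_pos (by linarith) hX'
      linarith
    refine ⟨by exact_mod_cast hD, ?_, ?_⟩
    · rw [one_le_div hD]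
      exact h3'
    · rw [div_le_div_iff₀ hD (by linarith)]
      have hε0 : 0 ≤ 1 + ε := by
        by_contra hneg
        nlinarith
      refine le_of_mul_le_mul_right ?_ hG'
      calc (O : ℝ) * (1 - ε) * c = (O * c) * (1 - ε) := by ring
        _ ≤ ((1 + ε) * x) * (1 - ε) := by
          rw [h1']
          exact mul_le_mul_of_nonneg_right (by linarith) (by linarith)
        _ = (1 + ε) * ((1 - ε) * x) := by ring
        _ ≤ (1 + ε) * (D * c) := mul_le_mul_of_nonneg_left h4 hε0
        _ = (1 + ε) * D * c := by ring

end Orbits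

/-! ### Lower bounds for the constants -/

section Constants

theorem one_add_two_div_le_thetaC {q : ℝ} (hq : 1 < q) : 1 + 2 / q ≤ thetaC q := by
  have hq0 : 0 < q := by linarith
  have hsum : Summable fun r : ℤ => q ^ (-(r ^ 2)) := by
    refine Summable.of_nonneg_of_le (f := fun r : ℤ => q⁻¹ ^ r.natAbs) (fun r => by positivity)
      (fun r => ?_) ?_
    · rw [inv_pow, zpow_neg, ← zpow_natCast]
      gcongr
      · exact hq.le
      · rw [← Int.natAbs_sq, sq]
        exact_mod_cast Nat.le_mul_self r.natAbs
    · have hgeo : Summable fun n : ℕ => q⁻¹ ^ n :=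
        summable_geometric_of_lt_one (by positivity) (inv_lt_one_of_one_lt₀ hq)
      exact Summable.of_nat_of_neg (by simpa using hgeo) (by simpa using hgeo)
  have h := hsum.sum_le_tsum ({-1, 0, 1} : Finset ℤ) (fun r _ => by positivity)
  rw [thetaC]
  refine le_trans (le_of_eq ?_) h
  rw [Finset.sum_insert (by decide), Finset.sum_insert (by decide), Finset.sum_singleton]
  norm_num
  ring

theorem one_le_eulerD {q : ℝ} (hq : 1 < q) : 1 ≤ eulerD q := by
  have hone : ∀ j : ℕ, 1 ≤ (1 - q ^ (-((j : ℤ) + 1)))⁻¹ := by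
    intro j
    have h1 : q ^ (-((j : ℤ) + 1)) < 1 := zpow_lt_one_of_neg₀ hq (by omega)
    have h2 : 0 < q ^ (-((j : ℤ) + 1)) := zpow_pos (by linarith) _
    exact (one_le_inv₀ (by linarith)).2 (by linarith)
  rw [eulerD]
  by_cases h : Multipliable fun j : ℕ => (1 - q ^ (-((j : ℤ) + 1)))⁻¹
  · refine ge_of_tendsto h.hasProd (Filter.Eventually.of_forall fun s => ?_)
    refine Finset.prod_induction _ (fun x => 1 ≤ x) (fun a b ha hb => ?_) le_rfl fun j _ => hone j
    exact one_le_mul_of_one_le_of_one_le ha hb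
  -- Convergence of the product need not be proved: the default value `1` satisfies the bound as
  -- well.
  · rw [tprod_eq_one_of_not_multipliable h]

theorem two_le_thetaC_sq_mul {q : ℝ} (hq : 1 < q) :
    2 ≤ thetaC q ^ 2 * eulerD q * q ^ (1 / 4 : ℝ) := by
  have hq0 : 0 < q := by linarith
  have h1 := one_add_two_div_le_thetaC hq
  have h2 := one_le_eulerD hq
  have h3 : 2 ≤ (1 + 2 / q) ^ 2 * q ^ (1 / 4 : ℝ) := by
    rw [← pow_le_pow_iff_left₀ (by norm_num) (by positivity) (show 4 ≠ 0 by norm_num), mul_pow,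
      ← Real.rpow_natCast (q ^ (1 / 4 : ℝ)), ← Real.rpow_mul hq0.le, ← pow_mul]
    norm_num
    -- After taking fourth powers, Bernoulli gives `(1 + 2/q)^8 q ≥ (1 + 16/q) q = q + 16`.
    have h4 := one_add_mul_le_pow (show (-2 : ℝ) ≤ 2 / q by
      have : 0 < 2 / q := by positivity
      linarith) 8
    calc (16 : ℝ) ≤ (1 + (8 : ℕ) * (2 / q)) * q := by
          have : (1 + ((8 : ℕ) : ℝ) * (2 / q)) * q = q + 16 := by field_simp; norm_num
          linarith
      _ ≤ _ := by gcongr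
  calc (2 : ℝ) ≤ (1 + 2 / q) ^ 2 * q ^ (1 / 4 : ℝ) := h3
    _ = (1 + 2 / q) ^ 2 * 1 * q ^ (1 / 4 : ℝ) := by ring
    _ ≤ _ := by gcongr

end Constants

/-! ### Bounding the fixed points of non-trivial matrices -/

section FixedPoints

variable {p d n : ℕ} [Fact p.Prime]

theorem natCard_GL_le :
    Nat.card (Matrix.GeneralLinearGroup (Fin d) (ZMod p)) ≤ p ^ (d * d) := by
  calc _ ≤ Nat.card (Matrix (Fin d) (Fin d) (ZMod p)) :=
        Nat.card_le_card_of_injective (fun g => g.1) Units.val_injective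
    _ = _ := by
      rw [Matrix, Nat.card_fun, Nat.card_fun, Nat.card_zmod, Nat.card_fin, ← pow_mul]

theorem natCard_fixedBy_le_two_mul (hn : 2 ≤ n) (hd : 2 ≤ d)
    {g : Matrix.GeneralLinearGroup (Fin d) (ZMod p)} (hg : g ≠ 1) :
    Nat.card (MulAction.fixedBy (LayerSubgroup p d n) g) ≤
      2 * galoisNumber p (layerRank p d n - 1) := by
  have h := natCard_invtSubmodule_le_of_not_scalar _ (LayerSpace.exists_map_ne_smul hn hd hg)
  rw [LayerSpace.finrank_eq, Nat.card_zmod] at h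
  exact (natCard_fixedBy_le g).trans h

theorem layerRank_pos (hn : 2 ≤ n) (hd : 2 ≤ d)
    {g : Matrix.GeneralLinearGroup (Fin d) (ZMod p)} (hg : g ≠ 1) : 1 ≤ layerRank p d n := by
  obtain ⟨x, hx⟩ := LayerSpace.exists_map_ne_smul hn hd hg 0
  have : Nontrivial (LayerSpace p d n) := ⟨_, _, hx⟩
  rw [← LayerSpace.finrank_eq]
  exact Module.finrank_pos

theorem natCard_fixedBy_two_mul_le (hd : 10 ≤ d)
    {g : Matrix.GeneralLinearGroup (Fin d) (ZMod p)} (hg : g ≠ 1) :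
    Nat.card (MulAction.fixedBy (LayerSubgroup p d 2) g) * p ^ (d * d + d) ≤
      Nat.card (LayerSubgroup p d 2) := by
  have hm := LayerSpace.sq_add_le_two_mul_finrank (p := p) (d := d)
  have ho : orderOf g ≠ 1 := fun h => hg (orderOf_eq_one_iff.1 h)
  have hl := Nat.minFac_prime ho
  set l := (orderOf g).minFac
  -- A non-trivial power of `g` of prime order; it fixes everything that `g` fixes.
  set h := g ^ (orderOf g / l) with hh
  have hol : orderOf h = l :=
    orderOf_pow_orderOf_div (orderOf_pos g).ne' (Nat.minFac_dvd _)
  have hh1 : h ≠ 1 := fun h0 => hl.one_lt.ne' (by rw [← hol, h0, orderOf_one])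
  have hhl : (LayerSpace.map (freeLift h.1) : Module.End (ZMod p) (LayerSpace p d 2)) ^ l = 1 := by
    rw [← LayerSpace.map_freeLift_pow, ← hol, pow_orderOf_eq_one]
    exact LayerSpace.map_freeLift_one
  have hsub : Nat.card (MulAction.fixedBy (LayerSubgroup p d 2) g) ≤
      Nat.card (MulAction.fixedBy (LayerSubgroup p d 2) h) := by
    refine Nat.card_le_card_of_injective (fun N => ⟨N.1, ?_⟩) ?_
    · have := MulAction.fixedBy_subset_fixedBy_zpow (LayerSubgroup p d 2) g
        ((orderOf g / l : ℕ) : ℤ) N.2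
      rwa [zpow_natCast] at this
    · intro N₁ N₂ h
      exact Subtype.ext (Subtype.ext_iff.1 h :)
  have hmain := natCard_invtSubmodule_mul_le_of_prime_order (by nlinarith) _ hl hhl
    (LayerSpace.le_finrank_range_map_sub hd hh1)
  rw [natCard_layerSubgroup, ← LayerSpace.finrank_eq]
  refine le_trans (Nat.mul_le_mul (hsub.trans (natCard_fixedBy_le h)) ?_) hmain
  exact Nat.pow_le_pow_right (Fact.out : p.Prime).pos hm

theorem sum_natCard_fixedBy_le [Fintype (Matrix.GeneralLinearGroup (Fin d) (ZMod p))]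
    (hdn : (n = 2 ∧ 10 ≤ d) ∨ (3 ≤ n ∧ 3 ≤ d)) :
    ((∑ g ∈ Finset.univ.erase (1 : Matrix.GeneralLinearGroup (Fin d) (ZMod p)),
      Nat.card (MulAction.fixedBy (LayerSubgroup p d n) g) : ℕ) : ℝ) ≤
      constK p n * (p : ℝ) ^ exponentX p d n * Nat.card (LayerSubgroup p d n) := by
  have hp2 : 2 ≤ p := (Fact.out : p.Prime).two_le
  have hp1 : (1 : ℝ) < p := by exact_mod_cast (by omega : 1 < p)
  have hp0 : (0 : ℝ) < p := by linarith
  have hC := one_add_two_div_le_thetaC hp1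
  have hC1 : 1 ≤ thetaC p := by
    have : (0 : ℝ) < 2 / p := by positivity
    linarith
  have hD := one_le_eulerD hp1
  have hcard : (Finset.univ.erase (1 : Matrix.GeneralLinearGroup (Fin d) (ZMod p))).card ≤
      p ^ (d * d) := by
    refine (Finset.card_le_univ _).trans ?_
    rw [← Nat.card_eq_fintype_card]
    exact natCard_GL_le
  rcases hdn with ⟨rfl, hd⟩ | ⟨hn, hd⟩
  · have h1 : (∑ g ∈ Finset.univ.erase (1 : Matrix.GeneralLinearGroup (Fin d) (ZMod p)),
        Nat.card (MulAction.fixedBy (LayerSubgroup p d 2) g)) * p ^ d ≤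
        Nat.card (LayerSubgroup p d 2) := by
      refine Nat.le_of_mul_le_mul_left ?_ (Nat.pow_pos (n := d * d) (show 0 < p by omega))
      calc _ = ∑ g ∈ Finset.univ.erase (1 : Matrix.GeneralLinearGroup (Fin d) (ZMod p)),
            Nat.card (MulAction.fixedBy (LayerSubgroup p d 2) g) * p ^ (d * d + d) := by
            rw [← Finset.sum_mul, pow_add]
            ring
        _ ≤ _ := Finset.sum_le_card_nsmul _ _ _ fun g hg =>
            natCard_fixedBy_two_mul_le hd (Finset.ne_of_mem_erase hg)
        _ ≤ _ := by
          rw [smul_eq_mul]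
          exact Nat.mul_le_mul_right _ hcard
    have hK : 1 ≤ constK p 2 := by
      rw [constK, if_pos rfl]
      have h2 : (1 : ℝ) ≤ (p : ℝ) ^ (17 / 4 : ℝ) := Real.one_le_rpow hp1.le (by norm_num)
      exact one_le_mul_of_one_le_of_one_le
        (one_le_mul_of_one_le_of_one_le (one_le_pow₀ hC1) (one_le_pow₀ hD)) h2
    rw [exponentX, if_pos rfl, Real.rpow_neg hp0.le, Real.rpow_natCast, mul_assoc]
    have h2 : ((∑ g ∈ Finset.univ.erase (1 : Matrix.GeneralLinearGroup (Fin d) (ZMod p)),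
        Nat.card (MulAction.fixedBy (LayerSubgroup p d 2) g) : ℕ) : ℝ) ≤
        ((p : ℝ) ^ d)⁻¹ * Nat.card (LayerSubgroup p d 2) := by
      rw [← div_eq_inv_mul, le_div_iff₀ (by positivity)]
      exact_mod_cast h1
    exact h2.trans (le_mul_of_one_le_left (by positivity) hK)
  · have hpos : (∑ g ∈ Finset.univ.erase (1 : Matrix.GeneralLinearGroup (Fin d) (ZMod p)),
        Nat.card (MulAction.fixedBy (LayerSubgroup p d n) g)) ≤
        p ^ (d * d) * (2 * galoisNumber p (layerRank p d n - 1)) := by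
      refine (Finset.sum_le_card_nsmul _ _ _ fun g hg => natCard_fixedBy_le_two_mul (by omega)
        (by omega) (Finset.ne_of_mem_erase hg)).trans ?_
      rw [smul_eq_mul]
      exact Nat.mul_le_mul_right _ hcard
    rw [natCard_layerSubgroup, constK, exponentX, if_neg (by omega), if_neg (by omega)]
    -- Dividing by the ratio `G_m / G_{m-1}` needs `d_n ≥ 1`, which any non-identity matrix
    -- supplies; without one the sum is empty.
    rcases (Finset.univ.erase (1 : Matrix.GeneralLinearGroup (Fin d) (ZMod p))).eq_empty_or_nonempty
      with he | ⟨g, hg⟩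
    · rw [he, Finset.sum_empty, Nat.cast_zero]
      positivity
    have hm := layerRank_pos (p := p) (n := n) (by omega) (by omega) (Finset.ne_of_mem_erase hg)
    obtain ⟨m, hm'⟩ := Nat.exists_eq_add_of_le' hm
    rw [hm', Nat.add_sub_cancel] at hpos
    rw [hm']
    have hratio := (galoisNumber_ratio hp2 m).1
    have hs : (0 : ℝ) < √(p : ℝ) ^ m := by positivity
    have h1 : (galoisNumber p m : ℝ) ≤ (√(p : ℝ) ^ m)⁻¹ * galoisNumber p (m + 1) := by
      rw [← div_eq_inv_mul, le_div_iff₀ hs]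
      have : (0 : ℝ) ≤ galoisNumber p m := Nat.cast_nonneg _
      nlinarith
    -- With `d_n = m + 1`, replacing `m / 2` by `d_n / 2` costs `p ^ (1/2)`; the remaining `p ^
    -- (1/4)` of `K` absorbs, with `C² D`, the factor 2.
    have h2 : (p : ℝ) ^ (3 / 4 : ℝ) * (p : ℝ) ^ ((d : ℝ) ^ 2 - ((m + 1 : ℕ) : ℝ) / 2) =
        (p : ℝ) ^ (1 / 4 : ℝ) * ((p : ℝ) ^ (d * d) * (√(p : ℝ) ^ m)⁻¹) := by
      rw [Real.sqrt_eq_rpow, ← Real.rpow_natCast ((p : ℝ) ^ (1 / 2 : ℝ)), ← Real.rpow_mul hp0.le,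
        ← Real.rpow_neg hp0.le, ← Real.rpow_natCast (p : ℝ) (d * d), ← Real.rpow_add hp0, ← Real.rpow_add hp0,
        ← Real.rpow_add hp0]
      congr 1
      push_cast
      ring
    calc _ ≤ ((p ^ (d * d) * (2 * galoisNumber p m) : ℕ) : ℝ) := by exact_mod_cast hpos
      _ = 2 * ((p : ℝ) ^ (d * d) * galoisNumber p m) := by push_cast; ring
      _ ≤ 2 * ((p : ℝ) ^ (d * d) * ((√(p : ℝ) ^ m)⁻¹ * galoisNumber p (m + 1))) := by gcongr
      _ ≤ (thetaC p ^ 2 * eulerD p * (p : ℝ) ^ (1 / 4 : ℝ)) *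
          ((p : ℝ) ^ (d * d) * ((√(p : ℝ) ^ m)⁻¹ * galoisNumber p (m + 1))) := by
        gcongr
        exact two_le_thetaC_sq_mul hp1
      _ = thetaC p ^ 2 * eulerD p * ((p : ℝ) ^ (1 / 4 : ℝ) *
          ((p : ℝ) ^ (d * d) * (√(p : ℝ) ^ m)⁻¹)) * galoisNumber p (m + 1) := by ring
      _ = _ := by rw [← h2]; ring

end FixedPoints

theorem theorem5 (p d n : ℕ) [Fact p.Prime]
    (hdn : (n = 2 ∧ 10 ≤ d) ∨ (3 ≤ n ∧ 3 ≤ d)) :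
    (1 ≤ (Nat.card (LayerOrbit p d n) : ℝ) *
          (Nat.card (Matrix.GeneralLinearGroup (Fin d) (ZMod p)) : ℝ) /
          (Nat.card (LayerSubgroup p d n) : ℝ) ∧
      (Nat.card (LayerOrbit p d n) : ℝ) *
          (Nat.card (Matrix.GeneralLinearGroup (Fin d) (ZMod p)) : ℝ) /
          (Nat.card (LayerSubgroup p d n) : ℝ) ≤
        1 + constK p n * (p : ℝ) ^ exponentX p d n) ∧
    (Nat.card (RegularLayerOrbit p d n) ≤ Nat.card (LayerOrbit p d n) ∧
      (constK p n * (p : ℝ) ^ exponentX p d n < 1 →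
        0 < Nat.card (RegularLayerOrbit p d n) ∧
        1 ≤ (Nat.card (LayerOrbit p d n) : ℝ) / (Nat.card (RegularLayerOrbit p d n) : ℝ) ∧
        (Nat.card (LayerOrbit p d n) : ℝ) / (Nat.card (RegularLayerOrbit p d n) : ℝ) ≤
          (1 + constK p n * (p : ℝ) ^ exponentX p d n) /
            (1 - constK p n * (p : ℝ) ^ exponentX p d n))) := by
  have := Fintype.ofFinite (Matrix.GeneralLinearGroup (Fin d) (ZMod p))
  have : Nonempty (LayerSubgroup p d n) := ⟨(layerSubgroupEquiv p d n).symm ⊥⟩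
  have h := orbit_estimates (G := Matrix.GeneralLinearGroup (Fin d) (ZMod p))
    (X := LayerSubgroup p d n) (sum_natCard_fixedBy_le hdn)
  unfold RegularLayerOrbit
  exact h
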